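/- **Setting.** Let $\mathcal A\subseteq\mathbb R^p$ be a set of atoms, $f:\mathbb R^p\to\mathbb R$, $\mu>0$, $\delta\in(0,1]$ (subproblem quality), $\varepsilon\ge 0$ (tolerance), $L_{-1}>0$ (initial Lipschitz estimate); $\|\cdot\|$ is the Euclidean norm. *Algorithms.* At iteration $t=0,1,\dots$ each algorithm computes a direction $d_t$ and a maximal step-size $\gamma_t^{\max}\in(-\infty,+\infty]$, sets $g_t=\langle-\nabla f(x_t),d_t\rangle$, returns $x_t$ if $g_t\le\delta\varepsilon$, and otherwise sets $x_{t+1}=x_t+\gamma_t d_t$, where $(\gamma_t,L_t)$ is the output of backtracking: choose $\tau>1$, $0<\eta\le1$ and $M\in[\eta L_{t-1},L_{t-1}]$; while $f(x_t+\gamma d_t)>f(x_t)-\gamma g_t+\frac{\gamma^2M}{2}\|d_t\|^2$ for $\gamma=\min\{g_t/(M\|d_t\|^2),\gamma_t^{\max}\}$, replace $M$ by $\tau M$; then $L_t=M$ and $\gamma_t=\gamma$. - AdaAFW and AdaPFW (Away-steps and Pairwise Frank--Wolfe with backtracking) start at an atom $x_0\in\mathcal A$ and maintain weights $\alpha_t$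 with $x_t=\sum_{v\in\mathcal S_t}\alpha_{v,t}v$, where $\mathcal S_t$ is the set of atoms of nonzero weight, $\alpha_{x_0,0}=1$. They choose $s_t\in\mathcal A$ and $v_t\in\mathcal S_t$ with $\langle\nabla f(x_t),s_t-x_t\rangle\le\delta\min_{s\in\mathcal A}\langle\nabla f(x_t),s-x_t\rangle$ and $\langle\nabla f(x_t),x_t-v_t\rangle\le\delta\min_{v\in\mathcal S_t}\langle\nabla f(x_t),x_t-v\rangle$. AdaAFW: if $\langle\nabla f(x_t),s_t-x_t\rangle\le\langle\nabla f(x_t),x_t-v_t\rangle$, then $d_t=s_t-x_t$, $\gamma_t^{\max}=1$, all weights are multiplied by $1-\gamma_t$ and $\gamma_t$ is added to the weight of $s_t$; otherwise $d_t=x_t-v_t$, $\gamma_t^{\max}=\alpha_{v_t,t}/(1-\alpha_{v_t,t})$, all weights are multiplied by $1+\gamma_t$ and $\gamma_t$ is subtracted from the weight of $v_t$. AdaPFW: $d_t=s_t-v_t$, $\gamma_t^{\max}=\alpha_{v_t,t}$, and weight $\gamma_t$ is moved from $v_t$ to $s_t$. - AdaMP (Matching Pursuit with backtracking) starts at $x_0\in\operatorname{lin}(\mathcal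 A)$ and, with $\mathcal B=\mathcal A\cup-\mathcal A$, chooses $d_t=s_t\in\mathcal B$ with $\langle\nabla f(x_t),s_t\rangle\le\delta\min_{s\in\mathcal B}\langle\nabla f(x_t),s\rangle$, and $\gamma_t^{\max}=+\infty$. An iteration that is carried out is *bad* if $\gamma_t=\gamma_t^{\max}<1$, and *good* otherwise. *Geometric constants.* $\operatorname{PWidth}(\mathcal A)=\inf_{K,x,r}\;\inf_{S}\;\sup_{s\in K\cap\mathcal A,\,v\in S}\langle r/\|r\|,s-v\rangle$, over the faces $K$ of $\operatorname{conv}(\mathcal A)$, $x\in K$, $0\ne r\in\operatorname{cone}(K-x)$, and the finite sets $S\subseteq K\cap\mathcal A$ such that $x$ is a convex combination of all elements of $S$ with positive weights. $\operatorname{mDW}(\mathcal B)=\inf_{0\ne d\in\operatorname{lin}(\mathcal B)}\sup_{z\in\mathcal B}\langle z,d\rangle/\|d\|$ and $\operatorname{radius}(\mathcal B)=\sup_{z\in\mathcal B}\|z\|$. **Theorem.** (A) Suppose that $\operatorname{conv}(\mathcal A)$ is compact, and that $f$ is differentiable at the points of $\operatorname{conv}(\mathcal A)$ and $\mu$-strongly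 convex on $\operatorname{conv}(\mathcal A)$. Let $h_t=f(x_t)-\min_{\operatorname{conv}(\mathcal A)}f$. Then for every good step $t$ of AdaAFW and of AdaPFW $$h_{t+1}\le(1-\delta^2\rho_t)h_t,\qquad \rho_t=\frac{\mu}{4L_t}\left(\frac{\operatorname{PWidth}(\mathcal A)}{\operatorname{diam}(\mathcal A)}\right)^2,$$ and for every good step of AdaPFW also $h_{t+1}\le(1-\rho_t')h_t$ with $\rho_t'=\min\Big\{\frac\delta2,\ \delta^2\frac{\mu}{L_t}\Big(\frac{\operatorname{PWidth}(\mathcal A)}{\operatorname{diam}(\operatorname{conv}(\mathcal A))}\Big)^2\Big\}$. (B) Suppose that $\mathcal B=\mathcal A\cup-\mathcal A$ is compact, and that $f$ is differentiable at the points of $\operatorname{lin}(\mathcal A)$ and $\mu$-strongly convex on $\operatorname{lin}(\mathcal A)$. Let $h_t=f(x_t)-\min_{\operatorname{lin}(\mathcal A)}f$. Then for every iteration $t$ that AdaMP carries out $$h_{t+1}\le(1-\delta^2\rho_t)h_t,\qquad \rho_t=\frac{\mu}{L_t}\left(\frac{\operatorname{mDW}(\mathcal B)}{\operatorname{radius}(\mathcal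 B)}\right)^2 .$$ -/

import Mathlib

open scoped RealInnerProductSpace

noncomputable section

namespace AdaFW

variable {E : Type*} [NormedAddCommGroup E] [InnerProductSpace ℝ E]

/-! ## Geometric constants of a set of atoms -/

/-- `K` is a (nonempty) face of the convex set `C`: a nonempty convex extreme subset. -/
def IsFace (C K : Set E) : Prop :=
  K.Nonempty ∧ Convex ℝ K ∧ IsExtreme ℝ C K

/-- `S` is an active set for `x` in `W`: a finite set of atoms `S ⊆ W` such that `x` is a convex
combination of all the elements of `S`, with all weights positive. -/
def IsActiveSet (W : Set E) (x : E) (S : Finset E) : Prop :=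
  (S : Set E) ⊆ W ∧
    ∃ w : E → ℝ, (∀ v ∈ S, 0 < w v) ∧ ∑ v ∈ S, w v = 1 ∧ ∑ v ∈ S, w v • v = x

/-- `r` belongs to `cone (K - x)` (with `K` convex, the conic hull of `K - x` consists of the
nonnegative multiples of its elements). -/
def InCone (K : Set E) (x r : E) : Prop :=
  ∃ c : ℝ, 0 ≤ c ∧ ∃ z ∈ K, r = c • (z - x)

/-- The pyramidal directional width of the atoms `W` in the direction `r` with base point `x`:
the minimum over active sets `S` for `x` of the maximum of `⟪r / ‖r‖, s - v⟫`
over `s ∈ W`, `v ∈ S`. -/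
def PdirW (W : Set E) (r x : E) : ℝ :=
  sInf {b : ℝ | ∃ S : Finset E, IsActiveSet W x S ∧
    b = sSup {c : ℝ | ∃ s ∈ W, ∃ v ∈ S, c = ⟪(‖r‖⁻¹ : ℝ) • r, s - v⟫}}

/-- The pyramidal width of the set of atoms `A`: the minimum of the pyramidal directional widths
of `K ∩ A` over the faces `K` of `conv A`, base points `x ∈ K` and nonzero feasible directions
`r ∈ cone (K - x)`. -/
def PWidth (A : Set E) : ℝ :=
  sInf {b : ℝ | ∃ K : Set E, ∃ x r : E,
    IsFace (convexHull ℝ A) K ∧ x ∈ K ∧ InCone K x r ∧ r ≠ 0 ∧ b = PdirW (K ∩ A) r x}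

/-- The minimal directional width of the set of atoms `B`. -/
def mDW (B : Set E) : ℝ :=
  sInf {b : ℝ | ∃ d ∈ Submodule.span ℝ B, d ≠ 0 ∧
    b = sSup {c : ℝ | ∃ z ∈ B, c = ⟪z, d⟫ / ‖d‖}}

/-- The radius of a set of atoms: the largest norm of an atom. -/
def radius (B : Set E) : ℝ :=
  sSup {c : ℝ | ∃ z ∈ B, c = ‖z‖}

/-- The suboptimality `f x - min_D f`. -/
def subopt (f : E → ℝ) (D : Set E) (x : E) : ℝ :=
  f x - sInf (f '' D)

/-! ## Backtracking line search -/

/-- The quadratic model `Q(γ, M) = f x - γ g + (γ² M / 2) ‖d‖²`. -/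
def quadModel (f : E → ℝ) (x d : E) (g γ M : ℝ) : ℝ :=
  f x - γ * g + γ ^ 2 * M / 2 * ‖d‖ ^ 2

/-- The trial step-size `min {g / (M ‖d‖²), γmax}`, where `γmax` may be `+∞`. -/
def trialStep (d : E) (g : ℝ) (γmax : WithTop ℝ) (M : ℝ) : ℝ :=
  match γmax with
  | ⊤ => g / (M * ‖d‖ ^ 2)
  | (b : ℝ) => min (g / (M * ‖d‖ ^ 2)) b

/-- The sufficient decrease condition for the Lipschitz estimate `M`. -/
def SuffDecrease (f : E → ℝ) (d x : E) (g : ℝ) (γmax : WithTop ℝ) (M : ℝ) : Prop :=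
  f (x + trialStep d g γmax M • d) ≤ quadModel f x d g (trialStep d g γmax M) M

/-- `(γ, L)` is a possible output of the backtracking procedure: choose `τ > 1`, `0 < η ≤ 1` and
an initial value `M₀ ∈ [η Lprev, Lprev]`, and multiply it by `τ` as long as the sufficient decrease
condition fails. -/
def StepSize (f : E → ℝ) (d x : E) (g Lprev : ℝ) (γmax : WithTop ℝ) (γ L : ℝ) : Prop :=
  ∃ τ η M₀ : ℝ, 1 < τ ∧ 0 < η ∧ η ≤ 1 ∧ M₀ ∈ Set.Icc (η * Lprev) Lprev ∧
    ∃ i : ℕ, (∀ j < i, ¬ SuffDecrease f d x g γmax (τ ^ j * M₀)) ∧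
      SuffDecrease f d x g γmax (τ ^ i * M₀) ∧
      L = τ ^ i * M₀ ∧ γ = trialStep d g γmax L

/-! ## The algorithms -/

/-- The quantities produced by an algorithm at iterations `0, 1, …`: iterates, update directions,
maximal step-sizes, step-sizes and Lipschitz estimates. -/
structure Trace (E : Type*) where
  x : ℕ → E
  d : ℕ → E
  γmax : ℕ → WithTop ℝ
  γ : ℕ → ℝ
  L : ℕ → ℝ

/-- The Lipschitz estimate `L_{t-1}` with which iteration `t` starts (`L_{-1} = Linit`). -/
def prevEstimate (Linit : ℝ) (L : ℕ → ℝ) : ℕ → ℝ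
  | 0 => Linit
  | t + 1 => L t

/-- Iteration `t` is a good step unless `γ_t = γ_t^max` and `γ_t^max < 1`. -/
def Trace.GoodStep (R : Trace E) (t : ℕ) : Prop :=
  ¬ ((R.γ t : WithTop ℝ) = R.γmax t ∧ R.γmax t < 1)

/-- The quantities that Away-steps and Pairwise Frank-Wolfe produce in addition: the weights of
the decomposition of the iterate as a convex combination of atoms, the Frank-Wolfe atoms `s_t`
and the away atoms `v_t`. -/
structure ActiveTrace (E : Type*) extends Trace E where
  α : ℕ → E →₀ ℝ
  s : ℕ → E
  v : ℕ → E

/-- The active set at iteration `t`: the atoms with nonzero weight. -/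
def ActiveTrace.activeSet (R : ActiveTrace E) (t : ℕ) : Finset E :=
  (R.α t).support

variable [CompleteSpace E]

/-- The quantity `g_t = ⟪-∇f(x_t), d_t⟫`. -/
def gap (f : E → ℝ) (x d : E) : ℝ :=
  ⟪-gradient f x, d⟫

/-- The part of iteration `t` that is common to all variants, after the update direction and the
maximal step-size have been computed. -/
structure CommonStep (f : E → ℝ) (δ ε Linit : ℝ) (R : Trace E) (t : ℕ) : Prop where
  /-- the algorithm does not return at this iteration -/
  not_returned : δ * ε < gap f (R.x t) (R.d t)
  step_size : StepSize f (R.d t) (R.x t) (gap f (R.x t) (R.d t)) (prevEstimate Linit R.L t)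
    (R.γmax t) (R.γ t) (R.L t)
  update : R.x (t + 1) = R.x t + R.γ t • R.d t

/-- The two approximate linear subproblems of Away-steps and Pairwise Frank-Wolfe, over the atoms
and over the active set (`a ≤ δ * min` is written as `a ≤ δ * b` for all competitors `b`). -/
structure Subproblems (f : E → ℝ) (A : Set E) (δ : ℝ) (R : ActiveTrace E) (t : ℕ) : Prop where
  s_mem : R.s t ∈ A
  s_quality : ∀ s ∈ A,
    ⟪gradient f (R.x t), R.s t - R.x t⟫ ≤ δ * ⟪gradient f (R.x t), s - R.x t⟫
  v_mem : R.v t ∈ R.activeSet t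
  v_quality : ∀ v ∈ R.activeSet t,
    ⟪gradient f (R.x t), R.x t - R.v t⟫ ≤ δ * ⟪gradient f (R.x t), R.x t - v⟫

/-- The test by which Away-steps Frank-Wolfe selects a Frank-Wolfe step. -/
def ChoosesFW (f : E → ℝ) (R : ActiveTrace E) (t : ℕ) : Prop :=
  ⟪gradient f (R.x t), R.s t - R.x t⟫ ≤ ⟪gradient f (R.x t), R.x t - R.v t⟫

/-- A run of AdaAFW (Away-steps Frank-Wolfe with backtracking line-search) that carries out
the iterations `0, …, T - 1`. -/
structure IsAdaAFW (f : E → ℝ) (A : Set E) (δ ε Linit : ℝ) (T : ℕ) (R : ActiveTrace E) :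
    Prop where
  init_mem : R.x 0 ∈ A
  init_weights : R.α 0 = Finsupp.single (R.x 0) 1
  subproblems : ∀ t < T, Subproblems f A δ R t
  fw_direction : ∀ t < T, ChoosesFW f R t → R.d t = R.s t - R.x t ∧ R.γmax t = 1
  away_direction : ∀ t < T, ¬ ChoosesFW f R t → R.d t = R.x t - R.v t ∧
    R.γmax t = ((R.α t (R.v t) / (1 - R.α t (R.v t)) : ℝ) : WithTop ℝ)
  common : ∀ t < T, CommonStep f δ ε Linit R.toTrace t
  fw_weights : ∀ t < T, ChoosesFW f R t →
    R.α (t + 1) = (1 - R.γ t) • R.α t + Finsupp.single (R.s t) (R.γ t)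
  away_weights : ∀ t < T, ¬ ChoosesFW f R t →
    R.α (t + 1) = (1 + R.γ t) • R.α t - Finsupp.single (R.v t) (R.γ t)

/-- A run of AdaPFW (Pairwise Frank-Wolfe with backtracking line-search) that carries out
the iterations `0, …, T - 1`. -/
structure IsAdaPFW (f : E → ℝ) (A : Set E) (δ ε Linit : ℝ) (T : ℕ) (R : ActiveTrace E) :
    Prop where
  init_mem : R.x 0 ∈ A
  init_weights : R.α 0 = Finsupp.single (R.x 0) 1
  subproblems : ∀ t < T, Subproblems f A δ R t
  direction : ∀ t < T, R.d t = R.s t - R.v t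
  max_step : ∀ t < T, R.γmax t = ((R.α t (R.v t) : ℝ) : WithTop ℝ)
  common : ∀ t < T, CommonStep f δ ε Linit R.toTrace t
  weights : ∀ t < T,
    R.α (t + 1) = R.α t + Finsupp.single (R.s t) (R.γ t) - Finsupp.single (R.v t) (R.γ t)

/-- The symmetrized set of atoms `A ∪ -A`. -/
def symmAtoms (A : Set E) : Set E :=
  A ∪ {z | -z ∈ A}

/-- A run of AdaMP (Matching Pursuit with backtracking line-search) that carries out
the iterations `0, …, T - 1`. The direction `d_t` is the selected atom. -/
structure IsAdaMP (f : E → ℝ) (A : Set E) (δ ε Linit : ℝ) (T : ℕ) (R : Trace E) :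
    Prop where
  init_mem : R.x 0 ∈ Submodule.span ℝ A
  direction_mem : ∀ t < T, R.d t ∈ symmAtoms A
  direction_quality : ∀ t < T, ∀ s ∈ symmAtoms A,
    ⟪gradient f (R.x t), R.d t⟫ ≤ δ * ⟪gradient f (R.x t), s⟫
  max_step : ∀ t < T, R.γmax t = ⊤
  common : ∀ t < T, CommonStep f δ ε Linit R t

end AdaFW

end

/-!
All three algorithms gain at least `γ g / 2` in an iteration, because the step-size satisfies
`γ ≤ g / (L ‖d‖²)` and passes the sufficient decrease test. If the step-size equals `g / (L ‖d‖²)`,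
the gain is `g² / (2 L ‖d‖²)`, and it remains to bound the suboptimality `h` by a multiple of `g²`.
The only other good steps have `γ ≥ 1` and gain at least `g / 2 ≥ δ h / 2`; these satisfy the claimed
rates because a passed test forces `μ ≤ L` under strong convexity (`CommonStep.μ_le_L`) and because
`PWidth A ≤ diam A`.

For Matching Pursuit, strong convexity on the subspace gives `2 μ h ≤ ‖p‖²` for the projected gradient
`p`, and `mDW * ‖p‖ ≤ g / δ` by the definition of the minimal directional width.

For the Frank-Wolfe variants, strong convexity gives `h ≤ ⟪r, z - x⟫ - μ / 2 * ‖z - x‖²` with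
`r = -∇f(x)` and `z` a minimizer, and the main point is `PWidth_mul_inner_le`: if the pairwise gaps
`⟪r, s - v⟫` are at most `G`, then `PWidth A * ⟪r, z - x⟫ ≤ G * ‖z - x‖`. For finitely many atoms one
would project `r` to the cone of feasible directions at `x` and apply the definition of the width in
the face that is normal to the residual. In general that cone need not be closed. Instead let `y` be
the projection of `x + l r` to `conv A` for a small `l > 0`, with residual `n = x + l r - y`. If `n` were
not constant on the minimal face around the midpoint `u` of `x` and `y`, its component along that
face would be feasible at `u`; the union of active sets of `x` and `y` is active for `u`, and in the
direction of that component it is within less than `PWidth A` of the top of the face, as `y` is close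
to `x`: this contradicts the definition of the width. So the face exposed by `n` contains `x`, `y` and the
active set of `x`, and the width of this face at `x` in the direction `y - x` gives the claim.

The Frank-Wolfe runs need one more fact: the weights stay a convex decomposition of the iterate
(`IsDecomposition`), which holds since `γ ≤ γmax`.
-/

namespace AdaFW

/-! ### Active sets -/

section Geometry

variable {E : Type*} [NormedAddCommGroup E] [InnerProductSpace ℝ E]

lemma IsActiveSet.of_subset {W W' : Set E} {x : E} {S : Finset E} (h : IsActiveSet W x S)
    (hS : (S : Set E) ⊆ W') : IsActiveSet W' x S :=
  ⟨hS, h.2⟩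

lemma IsActiveSet.nonempty {W : Set E} {x : E} {S : Finset E} (h : IsActiveSet W x S) :
    S.Nonempty := by
  obtain ⟨-, w, -, h1, -⟩ := h
  by_contra hS
  rw [Finset.not_nonempty_iff_eq_empty] at hS
  simp [hS] at h1

lemma IsActiveSet.mem_convexHull {W : Set E} {x : E} {S : Finset E} (h : IsActiveSet W x S) :
    x ∈ convexHull ℝ W := by
  obtain ⟨hW, w, h0, h1, rfl⟩ := h
  exact (convex_convexHull ℝ W).sum_mem (fun i hi => (h0 i hi).le) h1
    fun i hi => subset_convexHull ℝ W (hW hi)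

lemma exists_isActiveSet {W : Set E} {x : E} (hx : x ∈ convexHull ℝ W) :
    ∃ S, IsActiveSet W x S := by
  classical
  rw [convexHull_eq_union_convexHull_finite_subsets] at hx
  simp only [Set.mem_iUnion] at hx
  obtain ⟨t, ht, hx⟩ := hx
  obtain ⟨w, h0, h1, h2⟩ := Finset.mem_convexHull'.1 hx
  refine ⟨t.filter (w · ≠ 0), fun i hi => ht (Finset.mem_of_mem_filter i hi), w, ?_, ?_, ?_⟩
  · intro v hv
    rw [Finset.mem_filter] at hv
    exact lt_of_le_of_ne (h0 v hv.1) (Ne.symm hv.2)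
  · rw [Finset.sum_filter_ne_zero, h1]
  · rw [← h2]
    refine Finset.sum_subset (Finset.filter_subset _ _) fun i hi hi' => ?_
    have : w i = 0 := by simpa [hi] using hi'
    simp [this]

open Classical in
lemma IsActiveSet.midpoint {W : Set E} {x y : E} {S T : Finset E} (hS : IsActiveSet W x S)
    (hT : IsActiveSet W y T) :
    IsActiveSet W ((1 / 2 : ℝ) • x + (1 / 2 : ℝ) • y) (S ∪ T) := by
  obtain ⟨hSW, a, a0, a1, a2⟩ := hS
  obtain ⟨hTW, b, b0, b1, b2⟩ := hT
  have hA : ∀ v, 0 ≤ if v ∈ S then a v else 0 := fun v => by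
    split_ifs with h
    exacts [(a0 v h).le, le_rfl]
  have hB : ∀ v, 0 ≤ if v ∈ T then b v else 0 := fun v => by
    split_ifs with h
    exacts [(b0 v h).le, le_rfl]
  refine ⟨by simp [hSW, hTW], fun v => (1 / 2) * (if v ∈ S then a v else 0) +
    (1 / 2) * (if v ∈ T then b v else 0), ?_, ?_, ?_⟩
  · intro v hv
    rcases Finset.mem_union.1 hv with h | h
    · have := a0 v h
      have := hB v
      simp only [h, if_true]
      linarith
    · have := b0 v h
      have := hA v
      simp only [h, if_true]
      linarith
  · rw [Finset.sum_add_distrib, ← Finset.mul_sum, ← Finset.mul_sum, Finset.sum_ite_mem,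
      Finset.sum_ite_mem, Finset.union_inter_cancel_left, Finset.union_inter_cancel_right, a1, b1]
    norm_num
  · simp only [add_smul, mul_smul, ite_smul, zero_smul]
    rw [Finset.sum_add_distrib, ← Finset.smul_sum, ← Finset.smul_sum, Finset.sum_ite_mem,
      Finset.sum_ite_mem, Finset.union_inter_cancel_left, Finset.union_inter_cancel_right, a2, b2]

/-- The nonnegative numbers `⟪n, y - v⟫` have the weighted mean `⟪n, y - x⟫`, so each weighted term is
at most that mean. -/
lemma weight_mul_inner_le {S : Finset E} {w : E → ℝ} {x y n : E} (h0 : ∀ v ∈ S, 0 < w v)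
    (h1 : ∑ v ∈ S, w v = 1) (h2 : ∑ v ∈ S, w v • v = x) (hn : ∀ v ∈ S, 0 ≤ ⟪n, y - v⟫)
    {v : E} (hv : v ∈ S) : w v * ⟪n, y - v⟫ ≤ ⟪n, y - x⟫ := by
  have : ⟪n, y - x⟫ = ∑ v ∈ S, w v * ⟪n, y - v⟫ := by
    simp only [inner_sub_right, mul_sub, Finset.sum_sub_distrib]
    rw [← Finset.sum_mul, h1, ← h2, inner_sum]
    simp [inner_smul_right]
  rw [this]
  exact Finset.single_le_sum (f := fun v => w v * ⟪n, y - v⟫)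
    (fun i hi => mul_nonneg (h0 i hi).le (hn i hi)) hv

/-! ### Faces of a convex set -/

/-- The directions in which the convex set `C` extends on both sides of its point `u`. They form
the direction space of the minimal face of `C` that contains `u`. -/
def freeDirections {C : Set E} (hC : Convex ℝ C) {u : E} (hu : u ∈ C) : Submodule ℝ E where
  carrier := {d | ∃ t : ℝ, 0 < t ∧ u + t • d ∈ C ∧ u - t • d ∈ C}
  zero_mem' := ⟨1, one_pos, by simpa using hu, by simpa using hu⟩
  add_mem' := by
    rintro d e ⟨s, hs, hs1, hs2⟩ ⟨t, ht, ht1, ht2⟩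
    have hst : 0 < s + t := add_pos hs ht
    have hab : t / (s + t) + s / (s + t) = 1 := by field_simp; ring
    refine ⟨s * t / (s + t), by positivity, ?_, ?_⟩
    · convert hC hs1 ht1 (a := t / (s + t)) (b := s / (s + t)) (by positivity) (by positivity) hab
        using 1
      linear_combination (norm := module) (-hab) • u
    · convert hC hs2 ht2 (a := t / (s + t)) (b := s / (s + t)) (by positivity) (by positivity) hab
        using 1
      linear_combination (norm := module) (-hab) • u
  smul_mem' := by
    rintro c d ⟨t, ht, h1, h2⟩
    rcases lt_trichotomy c 0 with hc | rfl | hc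
    · have hc' : c ≠ 0 := hc.ne
      refine ⟨t / (-c), div_pos ht (by linarith), ?_, ?_⟩
      · convert h2 using 1
        rw [smul_smul, sub_eq_add_neg, ← neg_smul]
        congr 2
        field_simp
      · convert h1 using 1
        rw [smul_smul, sub_eq_add_neg, ← neg_smul]
        congr 2
        field_simp
    · exact ⟨1, one_pos, by simpa using hu, by simpa using hu⟩
    · have hc' : c ≠ 0 := hc.ne'
      refine ⟨t / c, div_pos ht hc, ?_, ?_⟩ <;> rwa [smul_smul, div_mul_cancel₀ _ hc']

lemma mem_freeDirections {C : Set E} {hC : Convex ℝ C} {u : E} {hu : u ∈ C} {d : E} :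
    d ∈ freeDirections hC hu ↔ ∃ t : ℝ, 0 < t ∧ u + t • d ∈ C ∧ u - t • d ∈ C :=
  Iff.rfl

/-- The points of `C` that are reached from `u` along a free direction form a face. -/
lemma isFace_freeDirections {C : Set E} (hC : Convex ℝ C) {u : E} (hu : u ∈ C) :
    IsFace C {s | s ∈ C ∧ s - u ∈ freeDirections hC hu} := by
  refine ⟨⟨u, hu, by simp⟩, ?_, ⟨fun s hs => hs.1, ?_⟩⟩
  · rintro a ⟨ha, ha'⟩ b ⟨hb, hb'⟩ s t hs ht hst
    refine ⟨hC ha hb hs ht hst, ?_⟩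
    have := add_mem (Submodule.smul_mem _ s ha') (Submodule.smul_mem _ t hb')
    convert this using 1
    linear_combination (norm := module) hst • u
  · rintro a ha b hb s ⟨hs, hs'⟩ ⟨p, q, hp, hq, hpq, rfl⟩
    obtain ⟨t, ht, -, h2⟩ := mem_freeDirections.1 hs'
    refine ⟨ha, mem_freeDirections.2 ?_⟩
    -- `(1 + t) u = (u - t (s - u)) + t p a + t q b` is solved for the reflection of `a` through `u`
    have hc : ∃ c ∈ C, (1 + t * q) • c =
        (u - t • (p • a + q • b - u)) + (t * q) • b := by
      have h3 : 0 < 1 + t * q := by positivity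
      refine ⟨_, hC h2 hb (a := 1 / (1 + t * q)) (b := t * q / (1 + t * q)) (by positivity)
        (by positivity) (by field_simp), ?_⟩
      rw [smul_add, smul_smul, smul_smul, mul_div_cancel₀ _ h3.ne', mul_div_cancel₀ _ h3.ne',
        one_smul]
    obtain ⟨c, hcC, hc⟩ := hc
    have h3 : 0 < 1 + t * q := by positivity
    have key : ∀ k : ℝ, k = t * p / (1 + t * q) → u - k • (a - u) = c := by
      intro k hk
      have hk' : (1 + t * q) * k = t * p := by rw [hk]; field_simp
      apply smul_right_injective E h3.ne'
      change (1 + t * q) • (u - k • (a - u)) = (1 + t * q) • c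
      rw [hc]
      linear_combination (norm := module) hk' • (u - a) + (t * hpq) • u
    obtain ⟨k, hk⟩ : ∃ k, k = t * p / (1 + t * q) := ⟨_, rfl⟩
    have hkpos : 0 < k := by rw [hk]; positivity
    -- the step must be at most `1` for `u + k (a - u)` to be in `C`
    refine ⟨min k 1, lt_min hkpos one_pos, ?_, ?_⟩
    · exact hC.add_smul_sub_mem hu ha ⟨(lt_min hkpos one_pos).le, min_le_right _ _⟩
    · have hle : min k 1 / k ≤ 1 := by
        rw [div_le_one hkpos]; exact min_le_left _ _
      have := hC.add_smul_sub_mem hu hcC ⟨(div_pos (lt_min hkpos one_pos) hkpos).le, hle⟩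
      rw [← key k hk] at this
      convert this using 1
      rw [sub_right_comm, sub_self, zero_sub, smul_neg, smul_smul, div_mul_cancel₀ _ hkpos.ne',
        sub_eq_add_neg]

/-- The maximizers over `C` of a linear functional form a face. -/
lemma isFace_exposed {C : Set E} (hC : Convex ℝ C) {n y : E} (hy : y ∈ C)
    (hn : ∀ s ∈ C, ⟪n, s - y⟫ ≤ 0) : IsFace C {s | s ∈ C ∧ ⟪n, s - y⟫ = 0} := by
  refine ⟨⟨y, hy, by simp⟩, ?_, ⟨fun s hs => hs.1, ?_⟩⟩
  · rintro a ⟨ha, ha'⟩ b ⟨hb, hb'⟩ s t hs ht hst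
    refine ⟨hC ha hb hs ht hst, ?_⟩
    have : s • a + t • b - y = s • (a - y) + t • (b - y) := by
      linear_combination (norm := module) hst • y
    rw [this, inner_add_right, inner_smul_right, inner_smul_right, ha', hb']
    ring
  · rintro a ha b hb s ⟨hs, hs'⟩ ⟨p, q, hp, hq, hpq, rfl⟩
    refine ⟨ha, le_antisymm (hn a ha) ?_⟩
    have : p • a + q • b - y = p • (a - y) + q • (b - y) := by
      linear_combination (norm := module) hpq • y
    rw [this, inner_add_right, inner_smul_right, inner_smul_right] at hs'
    have := hn b hb
    by_contra! h
    nlinarith [mul_neg_of_pos_of_neg hp h]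

/-- Each active atom `v` of `u` has positive weight, part of which can be removed: the segment from
`v` to `u` can be prolonged beyond `u`. -/
lemma sub_mem_freeDirections {A : Set E} {u : E} {S : Finset E} (hS : IsActiveSet A u S)
    {v : E} (hv : v ∈ S) :
    v - u ∈ freeDirections (convex_convexHull ℝ A) hS.mem_convexHull := by
  classical
  obtain ⟨hSA, w, w0, w1, w2⟩ := id hS
  have hvpos := w0 v hv
  refine mem_freeDirections.2 ⟨w v, hvpos, ?_, ?_⟩
  · have hle : w v ≤ 1 := by
      rw [← w1]
      exact Finset.single_le_sum (fun i hi => (w0 i hi).le) hv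
    exact (convex_convexHull ℝ A).add_smul_sub_mem hS.mem_convexHull
      (subset_convexHull ℝ A (hSA hv)) ⟨hvpos.le, hle⟩
  · have hmem : ∑ i ∈ S, ((1 + w v) * w i - if i = v then w v else 0) • i ∈ convexHull ℝ A := by
      refine (convex_convexHull ℝ A).sum_mem (fun i hi => ?_) ?_
        fun i hi => subset_convexHull ℝ A (hSA hi)
      · have := w0 i hi
        split_ifs with h
        · subst h
          nlinarith
        · nlinarith
      · rw [Finset.sum_sub_distrib, ← Finset.mul_sum, w1, Finset.sum_ite_eq' S v, if_pos hv]
        ring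
    convert hmem using 1
    simp only [sub_smul, mul_smul, ite_smul, zero_smul]
    rw [Finset.sum_sub_distrib, ← Finset.smul_sum, w2, Finset.sum_ite_eq' S v, if_pos hv]
    module

/-! ### The pyramidal width -/

lemma bddAbove_widths {W : Set E} (hW : Bornology.IsBounded W) (r : E) {S : Finset E}
    (hS : (S : Set E) ⊆ W) :
    BddAbove {c : ℝ | ∃ s ∈ W, ∃ v ∈ S, c = ⟪(‖r‖⁻¹ : ℝ) • r, s - v⟫} := by
  obtain ⟨D, hD⟩ := Metric.isBounded_iff.1 hW
  refine ⟨‖(‖r‖⁻¹ : ℝ) • r‖ * D, ?_⟩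
  rintro c ⟨s, hs, v, hv, rfl⟩
  refine (real_inner_le_norm _ _).trans ?_
  gcongr
  rw [← dist_eq_norm]
  exact hD hs (hS hv)

lemma sSup_widths_nonneg {W : Set E} (hW : Bornology.IsBounded W) {r x : E} {S : Finset E}
    (hS : IsActiveSet W x S) :
    0 ≤ sSup {c : ℝ | ∃ s ∈ W, ∃ v ∈ S, c = ⟪(‖r‖⁻¹ : ℝ) • r, s - v⟫} := by
  obtain ⟨v, hv⟩ := hS.nonempty
  exact le_csSup (bddAbove_widths hW r hS.1) ⟨v, hS.1 hv, v, hv, by simp⟩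

lemma PdirW_nonneg {W : Set E} (hW : Bornology.IsBounded W) (r x : E) : 0 ≤ PdirW W r x :=
  Real.sInf_nonneg (by rintro b ⟨S, hS, rfl⟩; exact sSup_widths_nonneg hW hS)

lemma PWidth_nonneg {A : Set E} (hA : Bornology.IsBounded A) : 0 ≤ PWidth A :=
  Real.sInf_nonneg (by
    rintro b ⟨K, x, r, -, -, -, -, rfl⟩
    exact PdirW_nonneg (hA.subset Set.inter_subset_right) r x)

lemma PdirW_mul_norm_le {W : Set E} (hW : Bornology.IsBounded W) {x r : E} {S : Finset E}
    {G : ℝ} (hr : r ≠ 0) (hS : IsActiveSet W x S)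
    (hG : ∀ s ∈ W, ∀ v ∈ S, ⟪r, s - v⟫ ≤ G) : PdirW W r x * ‖r‖ ≤ G := by
  have hr' : 0 < ‖r‖ := norm_pos_iff.2 hr
  rw [← le_div_iff₀ hr']
  have hle : PdirW W r x ≤ sSup {c : ℝ | ∃ s ∈ W, ∃ v ∈ S, c = ⟪(‖r‖⁻¹ : ℝ) • r, s - v⟫} := by
    refine csInf_le ⟨0, ?_⟩ ⟨S, hS, rfl⟩
    rintro b ⟨T, hT, rfl⟩
    exact sSup_widths_nonneg hW hT
  refine hle.trans ?_
  · obtain ⟨v, hv⟩ := hS.nonempty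
    refine csSup_le ⟨_, v, hS.1 hv, v, hv, rfl⟩ ?_
    rintro c ⟨s, hs, v, hv, rfl⟩
    rw [real_inner_smul_left, inv_mul_eq_div]
    gcongr
    exact hG s hs v hv

lemma PWidth_le_PdirW {A K : Set E} (hA : Bornology.IsBounded A) {x r : E}
    (hK : IsFace (convexHull ℝ A) K) (hx : x ∈ K) (hr : InCone K x r) (hr0 : r ≠ 0) :
    PWidth A ≤ PdirW (K ∩ A) r x := by
  refine csInf_le ⟨0, ?_⟩ ⟨K, x, r, hK, hx, hr, hr0, rfl⟩
  rintro b ⟨K, x, r, -, -, -, -, rfl⟩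
  exact PdirW_nonneg (hA.subset Set.inter_subset_right) r x

lemma PWidth_mul_norm_le {A K : Set E} (hA : Bornology.IsBounded A) {x r : E} {S : Finset E}
    {G : ℝ} (hK : IsFace (convexHull ℝ A) K) (hx : x ∈ K) (hr : InCone K x r)
    (hS : IsActiveSet (K ∩ A) x S) (hG : ∀ s ∈ K ∩ A, ∀ v ∈ S, ⟪r, s - v⟫ ≤ G) :
    PWidth A * ‖r‖ ≤ G := by
  by_cases hr0 : r = 0
  · obtain ⟨v, hv⟩ := hS.nonempty
    simpa [hr0] using hG v (hS.1 hv) v hv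
  · exact (mul_le_mul_of_nonneg_right (PWidth_le_PdirW hA hK hx hr hr0) (norm_nonneg r)).trans
      (PdirW_mul_norm_le (hA.subset Set.inter_subset_right) hr0 hS hG)

end Geometry

section PyramidalWidth

variable {E : Type*} [NormedAddCommGroup E] [InnerProductSpace ℝ E]

lemma PdirW_le_diam {W : Set E} (hW : Bornology.IsBounded W) {r x : E} (hr : r ≠ 0) :
    PdirW W r x ≤ Metric.diam W := by
  by_cases h : ∃ S, IsActiveSet W x S
  · obtain ⟨S, hS⟩ := h
    refine le_of_mul_le_mul_right ?_ (norm_pos_iff.2 hr)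
    refine PdirW_mul_norm_le hW hr hS fun s hs v hv => (real_inner_le_norm _ _).trans ?_
    rw [mul_comm, ← dist_eq_norm]
    gcongr
    exact Metric.dist_le_diam_of_mem hW hs (hS.1 hv)
  · have : {b : ℝ | ∃ S : Finset E, IsActiveSet W x S ∧
        b = sSup {c : ℝ | ∃ s ∈ W, ∃ v ∈ S, c = ⟪(‖r‖⁻¹ : ℝ) • r, s - v⟫}} = ∅ := by
      rw [Set.eq_empty_iff_forall_notMem]
      rintro b ⟨S, hS, -⟩
      exact h ⟨S, hS⟩
    rw [PdirW, this, Real.sInf_empty]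
    exact Metric.diam_nonneg

lemma PWidth_le_diam {A : Set E} (hA : Bornology.IsBounded A) : PWidth A ≤ Metric.diam A := by
  by_cases h : ∃ K : Set E, ∃ x r : E,
    IsFace (convexHull ℝ A) K ∧ x ∈ K ∧ InCone K x r ∧ r ≠ 0
  · obtain ⟨K, x, r, hK, hx, hr, hr0⟩ := h
    exact (PWidth_le_PdirW hA hK hx hr hr0).trans
      ((PdirW_le_diam (hA.subset Set.inter_subset_right) hr0).trans
        (Metric.diam_mono Set.inter_subset_right hA))
  · have : {b : ℝ | ∃ K : Set E, ∃ x r : E, IsFace (convexHull ℝ A) K ∧ x ∈ K ∧ InCone K x r ∧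
        r ≠ 0 ∧ b = PdirW (K ∩ A) r x} = ∅ := by
      rw [Set.eq_empty_iff_forall_notMem]
      rintro b ⟨K, x, r, h1, h2, h3, h4, -⟩
      exact h ⟨K, x, r, h1, h2, h3, h4⟩
    rw [PWidth, this, Real.sInf_empty]
    exact Metric.diam_nonneg

lemma norm_sub_le_diam {A : Set E} (hA : Bornology.IsBounded A) {x y : E}
    (hx : x ∈ convexHull ℝ A) (hy : y ∈ convexHull ℝ A) : ‖x - y‖ ≤ Metric.diam A := by
  rw [← dist_eq_norm, ← convexHull_diam]
  exact Metric.dist_le_diam_of_mem (isBounded_convexHull.2 hA) hx hy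

/-- Let `n` be normal to `conv A` at `y`, where `y` is so close to `x` that `‖y - x‖` is at most
`k < PWidth A` times each active weight of `x`. Then `⟪n, ·⟫` is constant on the minimal face around `(x + y) / 2`: otherwise the projection of `n` to the direction
space of that face would be a feasible direction at `(x + y) / 2` in which the width is less than
`PWidth A`. -/
lemma inner_residual_eq_zero [FiniteDimensional ℝ E] {A : Set E} (hA : Bornology.IsBounded A)
    {x y n : E} {S : Finset E} {w : E → ℝ} {k l : ℝ} (hSA : (S : Set E) ⊆ A)
    (w0 : ∀ v ∈ S, 0 < w v) (w1 : ∑ v ∈ S, w v = 1) (w2 : ∑ v ∈ S, w v • v = x)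
    (hk0 : 0 ≤ k) (hk : k < PWidth A) (hl : ∀ v ∈ S, l ≤ k * w v) (hyx : ‖y - x‖ ≤ l)
    (hy : y ∈ convexHull ℝ A) (hn : ∀ s ∈ convexHull ℝ A, ⟪n, s - y⟫ ≤ 0) :
    ⟪n, x - y⟫ = 0 ∧ ∀ v ∈ S, ⟪n, v - y⟫ = 0 := by
  classical
  have hS : IsActiveSet A x S := ⟨hSA, w, w0, w1, w2⟩
  obtain ⟨T, hT⟩ := exists_isActiveSet hy
  have hU := hS.midpoint hT
  have hxC := hS.mem_convexHull
  set u : E := (1 / 2 : ℝ) • x + (1 / 2 : ℝ) • y with hu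
  set C := convexHull ℝ A with hCdef
  have hC : Convex ℝ C := convex_convexHull ℝ A
  have huC : u ∈ C := hU.mem_convexHull
  set D := freeDirections hC huC with hD
  have hvD : ∀ v ∈ S ∪ T, v - u ∈ D := fun v hv => sub_mem_freeDirections hU hv
  have hxD : x - u ∈ D := by
    refine mem_freeDirections.2 ⟨1, one_pos, ?_, ?_⟩
    · simpa using hxC
    · convert hy using 1
      rw [hu]; module
  have hyD : y - u ∈ D := by
    refine mem_freeDirections.2 ⟨1, one_pos, ?_, ?_⟩
    · simpa using hy
    · convert hxC using 1
      rw [hu]; module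
  set m : E := D.starProjection n with hm
  have hmD : m ∈ D := D.starProjection_apply_mem n
  -- on the direction space, `n` and its projection `m` are the same functional
  have hnm : ∀ a b : E, a - u ∈ D → b - u ∈ D → ⟪m, a - b⟫ = ⟪n, a - b⟫ := by
    intro a b ha hb
    have hab : a - b ∈ D := by
      have := sub_mem ha hb
      rwa [sub_sub_sub_cancel_right] at this
    have := D.starProjection_inner_eq_zero n (a - b) hab
    rw [inner_sub_left, sub_eq_zero] at this
    exact this.symm
  have hm0 : m = 0 := by
    by_contra hm0
    have hmpos : 0 < ‖m‖ := norm_pos_iff.2 hm0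
    have hnn : ∀ v ∈ A, 0 ≤ ⟪n, y - v⟫ := fun v hv => by
      have := hn v (subset_convexHull ℝ A hv)
      rw [← neg_sub, inner_neg_right] at this
      linarith
    have hbound : ∀ v ∈ S ∪ T, ⟪n, y - v⟫ ≤ k * ‖m‖ := by
      intro v hv
      rcases Finset.mem_union.1 hv with h | h
      · have h1 := weight_mul_inner_le w0 w1 w2 (fun v hv => hnn v (hSA hv)) h
        rw [← hnm y x hyD hxD] at h1
        have h2 : ⟪m, y - x⟫ ≤ ‖m‖ * (k * w v) :=
          (real_inner_le_norm _ _).trans (by gcongr; exact hyx.trans (hl v h))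
        refine le_of_mul_le_mul_left ?_ (w0 v h)
        linarith
      · obtain ⟨hTA, b, b0, b1, b2⟩ := id hT
        have h1 := weight_mul_inner_le b0 b1 b2 (fun v hv => hnn v (hTA hv)) h
        rw [sub_self, inner_zero_right] at h1
        have h2 : ⟪n, y - v⟫ ≤ 0 := by
          by_contra! h3
          exact absurd h1 (not_le.2 (mul_pos (b0 v h) h3))
        exact h2.trans (by positivity)
    have hcone : InCone {s | s ∈ C ∧ s - u ∈ D} u m := by
      obtain ⟨t, ht, h1, -⟩ := mem_freeDirections.1 hmD
      refine ⟨t⁻¹, (inv_pos.2 ht).le, u + t • m, ⟨h1, ?_⟩, ?_⟩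
      · rw [add_sub_cancel_left]
        exact D.smul_mem t hmD
      · rw [add_sub_cancel_left, smul_smul, inv_mul_cancel₀ ht.ne', one_smul]
    have := PWidth_mul_norm_le hA (isFace_freeDirections hC huC) ⟨huC, by simp⟩ hcone
      (G := k * ‖m‖)
      (hU.of_subset fun v hv => ⟨⟨subset_convexHull ℝ A (hU.1 hv), hvD v hv⟩, hU.1 hv⟩) ?_
    · exact absurd (le_of_mul_le_mul_right this hmpos) (not_le.2 hk)
    · rintro s ⟨⟨hsC, hsD⟩, -⟩ v hv
      rw [hnm s v hsD (hvD v hv)]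
      have h1 : ⟪n, s - v⟫ = ⟪n, s - y⟫ + ⟪n, y - v⟫ := by
        rw [← inner_add_right, sub_add_sub_cancel]
      have h2 := hn s hsC
      have h3 := hbound v hv
      linarith
  constructor
  · rw [← hnm x y hxD hyD, hm0, inner_zero_left]
  · intro v hv
    rw [← hnm v y (hvD v (Finset.mem_union_left _ hv)) hyD, hm0, inner_zero_left]

lemma exists_projection_convex {C : Set E} (hC : Convex ℝ C) (hcpt : IsCompact C)
    (hne : C.Nonempty) (q : E) : ∃ y ∈ C, ∀ s ∈ C, ⟪q - y, s - y⟫ ≤ 0 := by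
  obtain ⟨y, hy, h⟩ := exists_norm_eq_iInf_of_complete_convex hne hcpt.isComplete hC q
  exact ⟨y, hy, (norm_eq_iInf_iff_real_inner_le_zero hC hy).1 h⟩

/-- **The pairwise gap controls the slope towards any point.** If `⟪r, s - v⟫ ≤ G` for all atoms
`s` and all active atoms `v` of `x`, then the slope of `⟪r, ·⟫` from `x` towards a point `z` of
`conv A` is at most `G / PWidth A`. The cone of feasible directions at `x` need not be assumed closed:
`r` is not projected to that cone, but `x + l r` is projected to `conv A` for a small `l > 0`. -/
theorem PWidth_mul_inner_le [FiniteDimensional ℝ E] {A : Set E}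
    (hcpt : IsCompact (convexHull ℝ A)) {x z r : E} {S : Finset E} {G : ℝ}
    (hS : IsActiveSet A x S) (hz : z ∈ convexHull ℝ A)
    (hG : ∀ s ∈ A, ∀ v ∈ S, ⟪r, s - v⟫ ≤ G) :
    PWidth A * ⟪r, z - x⟫ ≤ G * ‖z - x‖ := by
  have hA : Bornology.IsBounded A := hcpt.isBounded.subset (subset_convexHull ℝ A)
  have hG0 : 0 ≤ G := by
    obtain ⟨v, hv⟩ := hS.nonempty
    simpa using hG v (hS.1 hv) v hv
  rcases (PWidth_nonneg hA).eq_or_lt with h0 | hpos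
  · rw [← h0, zero_mul]
    positivity
  obtain ⟨hSA, w, w0, w1, w2⟩ := id hS
  have hC : Convex ℝ (convexHull ℝ A) := convex_convexHull ℝ A
  have hxC := hS.mem_convexHull
  obtain ⟨a, ha, haS⟩ : ∃ a : ℝ, 0 < a ∧ ∀ v ∈ S, a ≤ w v :=
    ⟨S.inf' hS.nonempty w, (Finset.lt_inf'_iff _).2 w0, fun v hv => Finset.inf'_le _ hv⟩
  obtain ⟨l, hl, hlr⟩ : ∃ l : ℝ, 0 < l ∧ l * ‖r‖ ≤ PWidth A / 2 * a := by
    refine ⟨PWidth A / 2 * a / (‖r‖ + 1), by positivity, ?_⟩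
    rw [div_mul_eq_mul_div, div_le_iff₀ (by positivity)]
    gcongr
    linarith
  obtain ⟨y, hy, hn⟩ := exists_projection_convex hC hcpt ⟨x, hxC⟩ (x + l • r)
  set n : E := x + l • r - y with hndef
  have hsplit : ∀ b : E, ⟪n, b⟫ = l * ⟪r, b⟫ - ⟪y - x, b⟫ := fun b => by
    rw [hndef, show x + l • r - y = l • r - (y - x) by abel, inner_sub_left,
      real_inner_smul_left]
  have hyx : ‖y - x‖ ≤ l * ‖r‖ := by
    have h1 := hn x hxC
    rw [hsplit, ← neg_sub y x, inner_neg_right, inner_neg_right,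
      real_inner_self_eq_norm_sq] at h1
    have h2 : ⟪r, y - x⟫ ≤ ‖r‖ * ‖y - x‖ := real_inner_le_norm _ _
    by_contra! h3
    have h4 : 0 < ‖y - x‖ := lt_of_le_of_lt (by positivity) h3
    nlinarith [mul_le_mul_of_nonneg_left h2 hl.le]
  obtain ⟨hnx, hnS⟩ := inner_residual_eq_zero hA hSA w0 w1 w2 (by positivity)
    (half_lt_self hpos) (l := l * ‖r‖)
    (fun v hv => hlr.trans (mul_le_mul_of_nonneg_left (haS v hv) (by positivity))) hyx hy hn
  -- the face exposed by the residual contains `x`, its active set and the direction `y - x`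
  have hwidth : PWidth A * ‖y - x‖ ≤ l * G := by
    refine PWidth_mul_norm_le hA (isFace_exposed hC hy hn) (x := x) (S := S) ⟨hxC, hnx⟩
      ⟨1, zero_le_one, y, ⟨hy, by simp⟩, by simp⟩
      (hS.of_subset fun v hv => ⟨⟨subset_convexHull ℝ A (hSA hv), hnS v hv⟩, hSA hv⟩) ?_
    rintro s ⟨⟨-, hs⟩, hsA⟩ v hv
    have h1 : ⟪n, s - v⟫ = 0 := by
      rw [← sub_sub_sub_cancel_right s v y, inner_sub_right, hs, hnS v hv, sub_zero]
    rw [hsplit] at h1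
    have h2 := mul_le_mul_of_nonneg_left (hG s hsA v hv) hl.le
    linarith
  have hslope : l * ⟪r, z - x⟫ ≤ ‖y - x‖ * ‖z - x‖ := by
    have h1 : ⟪n, z - x⟫ ≤ 0 := by
      rw [← sub_sub_sub_cancel_right z x y, inner_sub_right, hnx, sub_zero]
      exact hn z hz
    rw [hsplit] at h1
    have h2 : ⟪y - x, z - x⟫ ≤ ‖y - x‖ * ‖z - x‖ := real_inner_le_norm _ _
    linarith
  refine le_of_mul_le_mul_left ?_ hl
  calc l * (PWidth A * ⟪r, z - x⟫) = PWidth A * (l * ⟪r, z - x⟫) := by ring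
    _ ≤ PWidth A * (‖y - x‖ * ‖z - x‖) := by gcongr
    _ = PWidth A * ‖y - x‖ * ‖z - x‖ := by ring
    _ ≤ l * G * ‖z - x‖ := by gcongr
    _ = l * (G * ‖z - x‖) := by ring

end PyramidalWidth

/-! ### Strong convexity -/

section StrongConvexity

lemma subopt_nonneg {E : Type*} {C : Set E} {f : E → ℝ} (hf : BddBelow (f '' C)) {x : E} (hx : x ∈ C) :
    0 ≤ subopt f C x :=
  sub_nonneg.2 (csInf_le hf ⟨x, hx, rfl⟩)

lemma bddBelow_image {E : Type*} [NormedAddCommGroup E] [NormedSpace ℝ E] {C : Set E} (hC : IsCompact C) {f : E → ℝ}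
    (hd : ∀ x ∈ C, DifferentiableAt ℝ f x) : BddBelow (f '' C) :=
  hC.bddBelow_image fun x hx => (hd x hx).continuousAt.continuousWithinAt

variable {E : Type*} [NormedAddCommGroup E] [InnerProductSpace ℝ E] [CompleteSpace E]

lemma strongConvexOn_first_order {C : Set E} {μ : ℝ} {f : E → ℝ} (hf : StrongConvexOn C μ f)
    {x z : E} (hx : x ∈ C) (hz : z ∈ C) (hd : DifferentiableAt ℝ f x) :
    f x + ⟪gradient f x, z - x⟫ + μ / 2 * ‖z - x‖ ^ 2 ≤ f z := by
  have hder : HasDerivAt (fun t : ℝ => f (x + t • (z - x))) ⟪gradient f x, z - x⟫ 0 := by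
    have h1 : HasDerivAt (fun t : ℝ => x + t • (z - x)) (z - x) 0 := by
      simpa using ((hasDerivAt_id (0 : ℝ)).smul_const (z - x)).const_add x
    have h2 : HasFDerivAt f (InnerProductSpace.toDual ℝ E (gradient f x))
        (x + (0 : ℝ) • (z - x)) := by
      rw [zero_smul, add_zero]
      exact hd.hasGradientAt.hasFDerivAt
    have h3 := h2.comp_hasDerivAt (0 : ℝ) h1
    rwa [InnerProductSpace.toDual_apply_apply] at h3
  obtain ⟨-, hconv⟩ := id hf
  have hlim := hder.tendsto_slope_zero_right
  have hlim' : Filter.Tendsto (fun t : ℝ => f z - f x - (1 - t) * (μ / 2 * ‖z - x‖ ^ 2))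
      (nhdsWithin 0 (Set.Ioi 0)) (nhds (f z - f x - (1 - 0) * (μ / 2 * ‖z - x‖ ^ 2))) :=
    (Continuous.tendsto (by fun_prop) 0).mono_left nhdsWithin_le_nhds
  have hle := le_of_tendsto_of_tendsto hlim hlim' (by
    filter_upwards [Ioo_mem_nhdsGT (zero_lt_one (α := ℝ))] with t ht
    have h := hconv hx hz (a := 1 - t) (b := t) (by linarith [ht.2]) ht.1.le (by ring)
    have hpt : (1 - t) • x + t • z = x + t • (z - x) := by module
    rw [hpt, norm_sub_rev x z] at h
    simp only [smul_eq_mul, zero_add, zero_smul, add_zero] at h ⊢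
    rw [inv_mul_le_iff₀ ht.1]
    linarith)
  linarith

/-- The suboptimality on a compact set is bounded by the linear decrease towards a minimizer, up
to the quadratic term of strong convexity. -/
lemma exists_subopt_le {C : Set E} (hC : IsCompact C) {μ : ℝ} {f : E → ℝ}
    (hf : StrongConvexOn C μ f) (hd : ∀ x ∈ C, DifferentiableAt ℝ f x) {x : E} (hx : x ∈ C) :
    ∃ z ∈ C, subopt f C x ≤ ⟪-gradient f x, z - x⟫ - μ / 2 * ‖z - x‖ ^ 2 := by
  obtain ⟨z, hz, hmin⟩ := hC.exists_sInf_image_eq ⟨x, hx⟩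
    fun x hx => (hd x hx).continuousAt.continuousWithinAt
  refine ⟨z, hz, ?_⟩
  have := strongConvexOn_first_order hf hx hz (hd x hx)
  rw [subopt, hmin, inner_neg_left]
  linarith

/-- The suboptimality is at most the Frank-Wolfe gap. -/
lemma mul_subopt_le {A : Set E} (hC : IsCompact (convexHull ℝ A)) {μ δ g : ℝ} {f : E → ℝ}
    (hμ : 0 ≤ μ) (hδ : 0 ≤ δ) (hf : StrongConvexOn (convexHull ℝ A) μ f)
    (hd : ∀ x ∈ convexHull ℝ A, DifferentiableAt ℝ f x) {x : E} (hx : x ∈ convexHull ℝ A)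
    (hg : ∀ s ∈ A, δ * ⟪-gradient f x, s - x⟫ ≤ g) :
    δ * subopt f (convexHull ℝ A) x ≤ g := by
  obtain ⟨z, hz, h⟩ := exists_subopt_le hC hf hd hx
  have hz' : δ * ⟪-gradient f x, z - x⟫ ≤ g := by
    have hconv : Convex ℝ {s : E | δ * ⟪-gradient f x, s - x⟫ ≤ g} := by
      rintro a ha b hb p q hp hq hpq
      have : p • a + q • b - x = p • (a - x) + q • (b - x) := by
        linear_combination (norm := module) hpq • x
      simp only [Set.mem_ofPred_eq] at ha hb ⊢
      rw [this, inner_add_right, inner_smul_right, inner_smul_right]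
      have h1 := mul_le_mul_of_nonneg_left ha hp
      have h2 := mul_le_mul_of_nonneg_left hb hq
      have h3 : p * g + q * g = g := by rw [← add_mul, hpq, one_mul]
      linarith
    exact convexHull_min hg hconv hz
  have : 0 ≤ μ / 2 * ‖z - x‖ ^ 2 := by positivity
  exact (mul_le_mul_of_nonneg_left (h.trans (sub_le_self _ this)) hδ).trans hz'

/-- Geometric strong convexity: the suboptimality is controlled by the square of the pairwise
gap. -/
lemma PWidth_sq_mul_subopt_le [FiniteDimensional ℝ E] {A : Set E}
    (hC : IsCompact (convexHull ℝ A)) {μ G : ℝ} {f : E → ℝ} (hμ : 0 ≤ μ)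
    (hf : StrongConvexOn (convexHull ℝ A) μ f)
    (hd : ∀ x ∈ convexHull ℝ A, DifferentiableAt ℝ f x) {x : E} {S : Finset E}
    (hS : IsActiveSet A x S) (hG : ∀ s ∈ A, ∀ v ∈ S, ⟪-gradient f x, s - v⟫ ≤ G) :
    2 * μ * PWidth A ^ 2 * subopt f (convexHull ℝ A) x ≤ G ^ 2 := by
  obtain ⟨z, hz, h⟩ := exists_subopt_le hC hf hd hS.mem_convexHull
  have hw := PWidth_nonneg (hC.isBounded.subset (subset_convexHull ℝ A))
  have h1 := PWidth_mul_inner_le hC hS hz hG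
  have h2 := mul_le_mul_of_nonneg_left h (by positivity : 0 ≤ 2 * μ * PWidth A ^ 2)
  have h3 := mul_le_mul_of_nonneg_left h1 (by positivity : 0 ≤ 2 * μ * PWidth A)
  -- `2 a G ≤ a² + G²` with `a = μ ‖z - x‖ PWidth A`
  nlinarith [sq_nonneg (μ * PWidth A * ‖z - x‖ - G)]

end StrongConvexity

/-! ### Backtracking -/

section Backtracking

variable {E : Type*} [NormedAddCommGroup E]

lemma trialStep_eq_or (d : E) (g : ℝ) (γmax : WithTop ℝ) (M : ℝ) :
    trialStep d g γmax M = g / (M * ‖d‖ ^ 2) ∨ (trialStep d g γmax M : WithTop ℝ) = γmax := by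
  cases γmax with
  | top => exact Or.inl rfl
  | coe b =>
    rcases min_choice (g / (M * ‖d‖ ^ 2)) b with h | h
    · exact Or.inl h
    · exact Or.inr (congrArg _ h)

lemma trialStep_le_ratio (d : E) (g : ℝ) (γmax : WithTop ℝ) (M : ℝ) :
    trialStep d g γmax M ≤ g / (M * ‖d‖ ^ 2) := by
  cases γmax with
  | top => exact le_rfl
  | coe b => exact min_le_left _ _

lemma trialStep_le_max (d : E) (g : ℝ) (γmax : WithTop ℝ) (M : ℝ) :
    (trialStep d g γmax M : WithTop ℝ) ≤ γmax := by
  cases γmax with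
  | top => exact le_top
  | coe b => exact WithTop.coe_le_coe.2 (min_le_right _ _)

lemma trialStep_nonneg {d : E} {g : ℝ} {γmax : WithTop ℝ} {M : ℝ} (hg : 0 ≤ g) (hM : 0 ≤ M)
    (hmax : 0 ≤ γmax) : 0 ≤ trialStep d g γmax M := by
  have h : 0 ≤ g / (M * ‖d‖ ^ 2) := by positivity
  cases γmax with
  | top => exact h
  | coe b => exact le_min h (WithTop.coe_le_coe.1 hmax)

lemma StepSize.pos [InnerProductSpace ℝ E] {f : E → ℝ} {d x : E} {g Lprev : ℝ}
    {γmax : WithTop ℝ} {γ L : ℝ} (h : StepSize f d x g Lprev γmax γ L) (hL : 0 < Lprev) :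
    0 < L := by
  obtain ⟨τ, η, M₀, hτ, hη, -, hM, i, -, -, rfl, -⟩ := h
  have : 0 < M₀ := lt_of_lt_of_le (mul_pos hη hL) hM.1
  have : 0 < τ := one_pos.trans hτ
  positivity

end Backtracking

section Progress

variable {E : Type*} [NormedAddCommGroup E] [InnerProductSpace ℝ E] [CompleteSpace E]
  {f : E → ℝ} {δ ε Linit : ℝ} {R : Trace E} {t : ℕ}

namespace CommonStep

lemma L_pos (h : CommonStep f δ ε Linit R t) (hL : 0 < prevEstimate Linit R.L t) :
    0 < R.L t :=
  h.step_size.pos hL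

lemma gap_pos (h : CommonStep f δ ε Linit R t) (hδ : 0 < δ) (hε : 0 ≤ ε) :
    0 < gap f (R.x t) (R.d t) :=
  lt_of_le_of_lt (by positivity) h.not_returned

lemma norm_d_pos (h : CommonStep f δ ε Linit R t) (hδ : 0 < δ) (hε : 0 ≤ ε) :
    0 < ‖R.d t‖ := by
  rw [norm_pos_iff]
  intro h0
  have := h.gap_pos hδ hε
  simp [gap, h0] at this

lemma γ_eq (h : CommonStep f δ ε Linit R t) :
    R.γ t = trialStep (R.d t) (gap f (R.x t) (R.d t)) (R.γmax t) (R.L t) := by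
  obtain ⟨τ, η, M₀, -, -, -, -, i, -, -, -, h⟩ := h.step_size
  exact h

lemma γ_le_max (h : CommonStep f δ ε Linit R t) : (R.γ t : WithTop ℝ) ≤ R.γmax t := by
  rw [h.γ_eq]
  exact trialStep_le_max _ _ _ _

lemma γ_nonneg (h : CommonStep f δ ε Linit R t) (hδ : 0 < δ) (hε : 0 ≤ ε)
    (hL : 0 < prevEstimate Linit R.L t) (hmax : 0 ≤ R.γmax t) : 0 ≤ R.γ t := by
  rw [h.γ_eq]
  exact trialStep_nonneg (h.gap_pos hδ hε).le (h.L_pos hL).le hmax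

lemma f_le_quadModel (h : CommonStep f δ ε Linit R t) :
    f (R.x (t + 1)) ≤
      quadModel f (R.x t) (R.d t) (gap f (R.x t) (R.d t)) (R.γ t) (R.L t) := by
  rw [h.update]
  obtain ⟨τ, η, M₀, -, -, -, -, i, -, hs, hL, hγ⟩ := h.step_size
  rw [← hL, SuffDecrease, ← hγ] at hs
  exact hs

lemma γ_mul_le (h : CommonStep f δ ε Linit R t) (hδ : 0 < δ) (hε : 0 ≤ ε)
    (hL : 0 < prevEstimate Linit R.L t) :
    R.γ t * (R.L t * ‖R.d t‖ ^ 2) ≤ gap f (R.x t) (R.d t) := by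
  have h1 := h.L_pos hL
  have h2 := h.norm_d_pos hδ hε
  rw [← le_div_iff₀ (by positivity), h.γ_eq]
  exact trialStep_le_ratio _ _ _ _

lemma f_le (h : CommonStep f δ ε Linit R t) (hδ : 0 < δ) (hε : 0 ≤ ε)
    (hL : 0 < prevEstimate Linit R.L t) (hmax : 0 ≤ R.γmax t) :
    f (R.x (t + 1)) ≤ f (R.x t) - R.γ t * gap f (R.x t) (R.d t) / 2 := by
  have h1 := h.f_le_quadModel
  have h2 := mul_le_mul_of_nonneg_left (h.γ_mul_le hδ hε hL) (h.γ_nonneg hδ hε hL hmax)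
  rw [quadModel] at h1
  linarith

/-- A step of positive length that passes the sufficient decrease test reveals a Lipschitz
estimate not below the strong convexity modulus. -/
lemma μ_le_L {C : Set E} {μ : ℝ} (h : CommonStep f δ ε Linit R t) (hδ : 0 < δ) (hε : 0 ≤ ε)
    (hγ : 0 < R.γ t) (hf : StrongConvexOn C μ f) (hd : DifferentiableAt ℝ f (R.x t))
    (hx : R.x t ∈ C) (hx' : R.x (t + 1) ∈ C) : μ ≤ R.L t := by
  have h1 := strongConvexOn_first_order hf hx hx' hd
  have h2 := h.f_le_quadModel
  have h3 := h.norm_d_pos hδ hε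
  have h4 : R.x (t + 1) - R.x t = R.γ t • R.d t := by rw [h.update, add_sub_cancel_left]
  rw [h4, inner_smul_right, norm_smul, Real.norm_eq_abs, mul_pow, sq_abs] at h1
  rw [quadModel, gap, inner_neg_left] at h2
  have h5 : 0 < R.γ t ^ 2 * ‖R.d t‖ ^ 2 := by positivity
  by_contra! h6
  nlinarith

end CommonStep

lemma rate_of_quadratic_decrease {h h' g L n D w μ κ G : ℝ} (hL : 0 < L) (hn : 0 < n)
    (hnD : n ≤ D) (hG : 0 ≤ κ * G) (hg : κ * G ≤ g)
    (hh : 2 * μ * w ^ 2 * h ≤ G ^ 2) (hdec : h' ≤ h - g ^ 2 / (2 * L * n ^ 2)) :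
    h' ≤ (1 - κ ^ 2 * (μ / L * (w / D) ^ 2)) * h := by
  have hD : 0 < D := hn.trans_le hnD
  have h1 : κ ^ 2 * (μ / L * (w / D) ^ 2) * h = κ ^ 2 * (2 * μ * w ^ 2 * h) / (2 * L * D ^ 2) := by
    field_simp
  have h2 : κ ^ 2 * (2 * μ * w ^ 2 * h) / (2 * L * D ^ 2) ≤ g ^ 2 / (2 * L * n ^ 2) := by
    have h3 : κ ^ 2 * (2 * μ * w ^ 2 * h) ≤ g ^ 2 :=
      calc κ ^ 2 * (2 * μ * w ^ 2 * h) ≤ κ ^ 2 * G ^ 2 := by gcongr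
        _ = (κ * G) ^ 2 := by ring
        _ ≤ g ^ 2 := by gcongr
    gcongr
  linarith

/-- An iteration in which the maximal step-size is not active decreases the objective by
`g² / (2 L ‖d‖²)`. -/
lemma CommonStep.rate_of_inactive (h : CommonStep f δ ε Linit R t) (hδ : 0 < δ) (hε : 0 ≤ ε)
    (hL : 0 < prevEstimate Linit R.L t) (hmax : 0 ≤ R.γmax t)
    (hγ : (R.γ t : WithTop ℝ) ≠ R.γmax t) {C : Set E} {D w μ κ G : ℝ} (hdD : ‖R.d t‖ ≤ D)
    (hG : 0 ≤ κ * G) (hg : κ * G ≤ gap f (R.x t) (R.d t))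
    (hh : 2 * μ * w ^ 2 * subopt f C (R.x t) ≤ G ^ 2) :
    subopt f C (R.x (t + 1)) ≤
      (1 - κ ^ 2 * (μ / R.L t * (w / D) ^ 2)) * subopt f C (R.x t) := by
  have hLt := h.L_pos hL
  have hn := h.norm_d_pos hδ hε
  refine rate_of_quadratic_decrease hLt hn hdD hG hg hh ?_
  have hγ' : R.γ t = gap f (R.x t) (R.d t) / (R.L t * ‖R.d t‖ ^ 2) := by
    rw [h.γ_eq] at hγ
    rw [h.γ_eq]
    exact (trialStep_eq_or _ _ _ _).resolve_right hγ
  have h1 := h.f_le hδ hε hL hmax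
  have h2 : R.γ t * gap f (R.x t) (R.d t) / 2 =
      gap f (R.x t) (R.d t) ^ 2 / (2 * R.L t * ‖R.d t‖ ^ 2) := by
    rw [hγ']; field_simp
  rw [h2] at h1
  rw [subopt, subopt]
  linarith

/-- A step of length at least `1` decreases the objective by at least half the gap. -/
lemma CommonStep.rate_of_one_le (h : CommonStep f δ ε Linit R t) (hδ : 0 < δ) (hε : 0 ≤ ε)
    (hL : 0 < prevEstimate Linit R.L t) (hγ : 1 ≤ R.γ t) {C : Set E}
    (hh : δ * subopt f C (R.x t) ≤ gap f (R.x t) (R.d t)) :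
    subopt f C (R.x (t + 1)) ≤ (1 - δ / 2) * subopt f C (R.x t) := by
  have hmax : 0 ≤ R.γmax t :=
    le_trans (WithTop.coe_le_coe.2 (zero_le_one.trans hγ)) h.γ_le_max
  have h1 := h.f_le hδ hε hL hmax
  have h2 := mul_le_mul_of_nonneg_right hγ (h.gap_pos hδ hε).le
  simp only [subopt] at hh ⊢
  linarith

lemma rate_le_half {δ μ L w D : ℝ} (hδ : 0 < δ) (hδ1 : δ ≤ 1) (hμ : 0 < μ) (hμL : μ ≤ L)
    (hw : 0 ≤ w) (hwD : w ≤ D) : δ ^ 2 * (μ / (4 * L) * (w / D) ^ 2) ≤ δ / 2 := by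
  have hL : 0 < L := hμ.trans_le hμL
  have hD : 0 ≤ D := hw.trans hwD
  have h1 : (w / D) ^ 2 ≤ 1 := pow_le_one₀ (by positivity) (div_le_one_of_le₀ hwD hD)
  have h2 : μ / (4 * L) ≤ 1 / 4 := by
    rw [div_le_div_iff₀ (by positivity) (by norm_num)]
    linarith
  have h3 : μ / (4 * L) * (w / D) ^ 2 ≤ 1 / 4 * 1 := by gcongr
  have h4 : δ ^ 2 * (μ / (4 * L) * (w / D) ^ 2) ≤ δ ^ 2 * (1 / 4 * 1) := by gcongr
  nlinarith

end Progress

/-! ### Convex decompositions of the iterates -/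

section Decomposition

variable {E : Type*} [NormedAddCommGroup E] [InnerProductSpace ℝ E]

/-- `α` is the weight function of a decomposition of `x` as a convex combination of atoms. The two
linear conditions are stated through `Finsupp.linearCombination`, so that they pass to sums and
multiples of weight functions. -/
structure IsDecomposition (A : Set E) (x : E) (α : E →₀ ℝ) : Prop where
  mem : ∀ v, α v ≠ 0 → v ∈ A
  nonneg : ∀ v, 0 ≤ α v
  sum_eq : Finsupp.linearCombination ℝ (fun _ : E => (1 : ℝ)) α = 1
  comb_eq : Finsupp.linearCombination ℝ (id : E → E) α = x

namespace IsDecomposition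

variable {A : Set E} {x : E} {α : E →₀ ℝ}

lemma of_mem (hx : x ∈ A) : IsDecomposition A x (Finsupp.single x 1) where
  mem v hv := by
    classical
    rw [Finsupp.single_apply] at hv
    by_cases h : x = v
    · exact h ▸ hx
    · simp [h] at hv
  nonneg v := by
    classical
    rw [Finsupp.single_apply]
    split_ifs <;> norm_num
  sum_eq := by simp
  comb_eq := by simp

lemma isActiveSet (h : IsDecomposition A x α) : IsActiveSet A x α.support := by
  refine ⟨fun v hv => h.mem v (Finsupp.mem_support_iff.1 hv), α, fun v hv => ?_, ?_, ?_⟩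
  · exact lt_of_le_of_ne (h.nonneg v) (Ne.symm (Finsupp.mem_support_iff.1 hv))
  · simpa [Finsupp.linearCombination_apply, Finsupp.sum] using h.sum_eq
  · simpa [Finsupp.linearCombination_apply, Finsupp.sum] using h.comb_eq

lemma weight_le_one (h : IsDecomposition A x α) {v : E} (hv : v ∈ α.support) : α v ≤ 1 := by
  have h1 : ∑ v ∈ α.support, α v = 1 := by
    simpa [Finsupp.linearCombination_apply, Finsupp.sum] using h.sum_eq
  rw [← h1]
  exact Finset.single_le_sum (fun i _ => h.nonneg i) hv

lemma eq_of_weight_eq_one (h : IsDecomposition A x α) {v : E} (hv : α v = 1) : x = v := by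
  classical
  have h1 : ∑ v ∈ α.support, α v = 1 := by
    simpa [Finsupp.linearCombination_apply, Finsupp.sum] using h.sum_eq
  have hmem : v ∈ α.support := by
    rw [Finsupp.mem_support_iff, hv]; exact one_ne_zero
  have h2 : ∑ i ∈ α.support.erase v, α i = 0 := by
    have := Finset.add_sum_erase α.support (fun i => α i) hmem
    rw [h1, hv] at this
    linarith
  have h3 := (Finset.sum_eq_zero_iff_of_nonneg fun i _ => h.nonneg i).1 h2
  have h4 : α = Finsupp.single v 1 := by
    ext i
    rw [Finsupp.single_apply]
    split_ifs with hi
    · rw [← hi, hv]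
    · by_contra hne
      exact hne (h3 i (Finset.mem_erase.2 ⟨Ne.symm hi, Finsupp.mem_support_iff.2 hne⟩))
  rw [← h.comb_eq, h4]
  simp

lemma weight_lt_one (h : IsDecomposition A x α) {v : E} (hv : v ∈ α.support) (hne : x ≠ v) :
    α v < 1 :=
  lt_of_le_of_ne (h.weight_le_one hv) fun h1 => hne (h.eq_of_weight_eq_one h1)

lemma fw_update (h : IsDecomposition A x α) {s : E} (hs : s ∈ A) {γ : ℝ} (h0 : 0 ≤ γ)
    (h1 : γ ≤ 1) :
    IsDecomposition A (x + γ • (s - x)) ((1 - γ) • α + Finsupp.single s γ) where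
  mem v hv := by
    classical
    by_cases hvs : s = v
    · exact hvs ▸ hs
    · refine h.mem v fun h0 => hv ?_
      simp [hvs, h0]
  nonneg v := by
    classical
    have := mul_nonneg (sub_nonneg.2 h1) (h.nonneg v)
    rw [Finsupp.add_apply, Finsupp.smul_apply, Finsupp.single_apply, smul_eq_mul]
    split_ifs <;> linarith
  sum_eq := by
    rw [map_add, map_smul, h.sum_eq, Finsupp.linearCombination_single]
    simp
  comb_eq := by
    rw [map_add, map_smul, h.comb_eq, Finsupp.linearCombination_single, id]
    module

lemma away_update (h : IsDecomposition A x α) {v : E} (hv : v ∈ A) {γ : ℝ} (h0 : 0 ≤ γ)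
    (h1 : γ * (1 - α v) ≤ α v) :
    IsDecomposition A (x + γ • (x - v)) ((1 + γ) • α - Finsupp.single v γ) where
  mem i hi := by
    classical
    by_cases hvi : v = i
    · exact hvi ▸ hv
    · refine h.mem i fun h0 => hi ?_
      simp [hvi, h0]
  nonneg i := by
    classical
    have := mul_nonneg h0 (h.nonneg i)
    have := h.nonneg i
    rw [Finsupp.sub_apply, Finsupp.smul_apply, Finsupp.single_apply, smul_eq_mul]
    split_ifs with hvi
    · subst hvi
      linarith
    · linarith
  sum_eq := by
    rw [map_sub, map_smul, h.sum_eq, Finsupp.linearCombination_single]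
    simp
  comb_eq := by
    rw [map_sub, map_smul, h.comb_eq, Finsupp.linearCombination_single, id]
    module

lemma pairwise_update (h : IsDecomposition A x α) {s v : E} (hs : s ∈ A) (hv : v ∈ A) {γ : ℝ}
    (h0 : 0 ≤ γ) (h1 : γ ≤ α v) :
    IsDecomposition A (x + γ • (s - v)) (α + Finsupp.single s γ - Finsupp.single v γ) where
  mem i hi := by
    classical
    by_cases hsi : s = i
    · exact hsi ▸ hs
    by_cases hvi : v = i
    · exact hvi ▸ hv
    refine h.mem i fun h0 => hi ?_
    simp [hvi, hsi, h0]
  nonneg i := by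
    classical
    have := h.nonneg i
    rw [Finsupp.sub_apply, Finsupp.add_apply, Finsupp.single_apply, Finsupp.single_apply]
    split_ifs with hsi hvi hvi
    · linarith
    · linarith
    · subst hvi
      linarith
    · linarith
  sum_eq := by
    rw [map_sub, map_add, h.sum_eq, Finsupp.linearCombination_single,
      Finsupp.linearCombination_single]
    simp
  comb_eq := by
    rw [map_sub, map_add, h.comb_eq, Finsupp.linearCombination_single,
      Finsupp.linearCombination_single, id, id]
    module

end IsDecomposition

end Decomposition

/-! ### Away-steps and Pairwise Frank-Wolfe -/

section FrankWolfe

variable {E : Type*} [NormedAddCommGroup E] [InnerProductSpace ℝ E] [CompleteSpace E]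
  {f : E → ℝ} {A : Set E} {δ ε Linit μ : ℝ} {T t : ℕ} {R : ActiveTrace E}

lemma Subproblems.fw_le (h : Subproblems f A δ R t) {s : E} (hs : s ∈ A) :
    δ * ⟪-gradient f (R.x t), s - R.x t⟫ ≤ ⟪-gradient f (R.x t), R.s t - R.x t⟫ := by
  have := h.s_quality s hs
  rw [inner_neg_left, inner_neg_left]
  linarith

lemma Subproblems.away_le (h : Subproblems f A δ R t) {v : E} (hv : v ∈ R.activeSet t) :
    δ * ⟪-gradient f (R.x t), R.x t - v⟫ ≤ ⟪-gradient f (R.x t), R.x t - R.v t⟫ := by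
  have := h.v_quality v hv
  rw [inner_neg_left, inner_neg_left]
  linarith

lemma Subproblems.pairwise_le (h : Subproblems f A δ R t) {s v : E} (hs : s ∈ A)
    (hv : v ∈ R.activeSet t) :
    δ * ⟪-gradient f (R.x t), s - v⟫ ≤ ⟪-gradient f (R.x t), R.s t - R.v t⟫ := by
  have h1 := h.fw_le hs
  have h2 := h.away_le hv
  rw [← sub_add_sub_cancel s (R.x t) v, ← sub_add_sub_cancel (R.s t) (R.x t) (R.v t),
    inner_add_right, inner_add_right]
  linarith

/-- A good step either has the unconstrained length `g / (L ‖d‖²)`, or has length at least `1` and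
then halves, up to the factor `δ`, the suboptimality. -/
lemma CommonStep.rate_of_goodStep [FiniteDimensional ℝ E] {κ : ℝ}
    (h : CommonStep f δ ε Linit R.toTrace t) (hgood : R.GoodStep t)
    (hsub : Subproblems f A δ R t)
    (hx : IsDecomposition A (R.x t) (R.α t))
    (hx' : IsDecomposition A (R.x (t + 1)) (R.α (t + 1)))
    (hμ : 0 < μ) (hδ : 0 < δ) (hε : 0 ≤ ε) (hL : 0 < prevEstimate Linit R.L t)
    (hmax : 0 ≤ R.γmax t) (hC : IsCompact (convexHull ℝ A))
    (hd : ∀ x ∈ convexHull ℝ A, DifferentiableAt ℝ f x)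
    (hf : StrongConvexOn (convexHull ℝ A) μ f)
    (hdD : ‖R.d t‖ ≤ Metric.diam A) (hκ : 0 ≤ κ)
    (hpair : κ * ⟪-gradient f (R.x t), R.s t - R.v t⟫ ≤ δ * gap f (R.x t) (R.d t))
    (hfw : ⟪-gradient f (R.x t), R.s t - R.x t⟫ ≤ gap f (R.x t) (R.d t)) :
    subopt f (convexHull ℝ A) (R.x (t + 1)) ≤
        (1 - κ ^ 2 * (μ / R.L t * (PWidth A / Metric.diam A) ^ 2)) *
          subopt f (convexHull ℝ A) (R.x t) ∨
      subopt f (convexHull ℝ A) (R.x (t + 1)) ≤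
          (1 - δ / 2) * subopt f (convexHull ℝ A) (R.x t) ∧ μ ≤ R.L t := by
  have hxC := hx.isActiveSet.mem_convexHull
  by_cases hγ : (R.γ t : WithTop ℝ) = R.γmax t
  · right
    have h1 : 1 ≤ R.γ t := by
      by_contra! h1
      refine hgood ⟨hγ, ?_⟩
      rw [← hγ]
      exact WithTop.coe_lt_coe.2 h1
    refine ⟨h.rate_of_one_le hδ hε hL h1 ?_, h.μ_le_L hδ hε (one_pos.trans_le h1) hf
      (hd _ hxC) hxC hx'.isActiveSet.mem_convexHull⟩
    exact mul_subopt_le hC hμ.le hδ.le hf hd hxC fun s hs =>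
      (hsub.fw_le hs).trans hfw
  · left
    have hG : ∀ s ∈ A, ∀ v ∈ R.activeSet t, ⟪-gradient f (R.x t), s - v⟫ ≤
        ⟪-gradient f (R.x t), R.s t - R.v t⟫ / δ := fun s hs v hv => by
      rw [le_div_iff₀ hδ, mul_comm]
      exact hsub.pairwise_le hs hv
    refine h.rate_of_inactive hδ hε hL hmax hγ hdD ?_ ?_
      (PWidth_sq_mul_subopt_le hC hμ.le hf hd hx.isActiveSet hG)
    · have := hG _ (hx.isActiveSet.1 hsub.v_mem) _ hsub.v_mem
      rw [sub_self, inner_zero_right] at this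
      exact mul_nonneg hκ this
    · rw [mul_div_assoc', div_le_iff₀ hδ, mul_comm _ δ]
      exact hpair

namespace IsAdaAFW

/-- The facts about one iteration that keep the weights a convex decomposition. -/
lemma step_invariant (hR : IsAdaAFW f A δ ε Linit T R) (hδ : 0 < δ) (hε : 0 ≤ ε) (ht : t < T)
    (hx : IsDecomposition A (R.x t) (R.α t)) (hL : 0 < prevEstimate Linit R.L t) :
    0 ≤ R.γmax t ∧ IsDecomposition A (R.x (t + 1)) (R.α (t + 1)) := by
  have hc := hR.common t ht
  have hs := hR.subproblems t ht
  have hle := hc.γ_le_max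
  have hnd := hc.norm_d_pos hδ hε
  rw [hc.update]
  by_cases hch : ChoosesFW f R t
  · obtain ⟨hd, hm⟩ := hR.fw_direction t ht hch
    have hmax : 0 ≤ R.γmax t := by rw [hm]; exact zero_le_one
    rw [hm] at hle
    rw [hR.fw_weights t ht hch, hd]
    exact ⟨hmax, hx.fw_update hs.s_mem (hc.γ_nonneg hδ hε hL hmax) (WithTop.coe_le_coe.1 hle)⟩
  · obtain ⟨hd, hm⟩ := hR.away_direction t ht hch
    have hlt : R.α t (R.v t) < 1 := by
      refine hx.weight_lt_one hs.v_mem fun h => ?_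
      rw [hd, h] at hnd
      simp at hnd
    have hmax : 0 ≤ R.γmax t := by
      rw [hm]
      exact WithTop.coe_le_coe.2 (div_nonneg (hx.nonneg _) (sub_nonneg.2 hlt.le))
    rw [hm, WithTop.coe_le_coe, le_div_iff₀ (sub_pos.2 hlt)] at hle
    rw [hR.away_weights t ht hch, hd]
    exact ⟨hmax, hx.away_update (hx.isActiveSet.1 hs.v_mem) (hc.γ_nonneg hδ hε hL hmax) hle⟩

lemma invariant (hR : IsAdaAFW f A δ ε Linit T R) (hδ : 0 < δ) (hε : 0 ≤ ε) (hL : 0 < Linit)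
    (ht : t ≤ T) :
    IsDecomposition A (R.x t) (R.α t) ∧ 0 < prevEstimate Linit R.L t := by
  induction t with
  | zero => exact ⟨by rw [hR.init_weights]; exact .of_mem hR.init_mem, hL⟩
  | succ t ih =>
    obtain ⟨h1, h2⟩ := ih (by omega)
    exact ⟨(hR.step_invariant hδ hε ht h1 h2).2, (hR.common t ht).L_pos h2⟩

/-- The selected direction captures at least half of the pairwise gap and all of the Frank-Wolfe
gap. -/
lemma gap_bounds (hR : IsAdaAFW f A δ ε Linit T R) (ht : t < T) :
    ⟪-gradient f (R.x t), R.s t - R.v t⟫ ≤ 2 * gap f (R.x t) (R.d t) ∧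
      ⟪-gradient f (R.x t), R.s t - R.x t⟫ ≤ gap f (R.x t) (R.d t) := by
  rw [← sub_add_sub_cancel (R.s t) (R.x t) (R.v t), inner_add_right]
  by_cases hch : ChoosesFW f R t
  · rw [(hR.fw_direction t ht hch).1, gap]
    rw [ChoosesFW] at hch
    simp only [inner_neg_left]
    constructor <;> linarith
  · rw [(hR.away_direction t ht hch).1, gap]
    rw [ChoosesFW] at hch
    simp only [inner_neg_left]
    constructor <;> linarith

theorem rate [FiniteDimensional ℝ E] (hR : IsAdaAFW f A δ ε Linit T R) (hμ : 0 < μ)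
    (hδ : 0 < δ) (hδ1 : δ ≤ 1) (hε : 0 ≤ ε) (hL : 0 < Linit) (hC : IsCompact (convexHull ℝ A))
    (hd : ∀ x ∈ convexHull ℝ A, DifferentiableAt ℝ f x)
    (hf : StrongConvexOn (convexHull ℝ A) μ f) (ht : t < T) (hgood : R.GoodStep t) :
    subopt f (convexHull ℝ A) (R.x (t + 1)) ≤
      (1 - δ ^ 2 * (μ / (4 * R.L t) * (PWidth A / Metric.diam A) ^ 2)) *
        subopt f (convexHull ℝ A) (R.x t) := by
  have hA : Bornology.IsBounded A := hC.isBounded.subset (subset_convexHull ℝ A)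
  obtain ⟨hx, hLt⟩ := hR.invariant hδ hε hL ht.le
  obtain ⟨hmax, hx'⟩ := hR.step_invariant hδ hε ht hx hLt
  have hc := hR.common t ht
  have hs := hR.subproblems t ht
  have hxC := hx.isActiveSet.mem_convexHull
  obtain ⟨hg1, hg2⟩ := hR.gap_bounds ht
  have hdD : ‖R.d t‖ ≤ Metric.diam A := by
    by_cases hch : ChoosesFW f R t
    · rw [(hR.fw_direction t ht hch).1]
      exact norm_sub_le_diam hA (subset_convexHull ℝ A hs.s_mem) hxC
    · rw [(hR.away_direction t ht hch).1]
      exact norm_sub_le_diam hA hxC (subset_convexHull ℝ A (hx.isActiveSet.1 hs.v_mem))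
  rcases hc.rate_of_goodStep hgood hs hx hx' hμ hδ hε hLt hmax hC hd hf hdD (κ := δ / 2)
    (by positivity) (by nlinarith) hg2 with h | ⟨h, hμL⟩
  · refine h.trans_eq ?_
    congr 2
    rw [mul_comm (4 : ℝ), ← div_div]
    ring
  · refine h.trans (mul_le_mul_of_nonneg_right ?_ (subopt_nonneg (bddBelow_image hC hd) hxC))
    have := rate_le_half hδ hδ1 hμ hμL (PWidth_nonneg hA) (PWidth_le_diam hA)
    linarith

end IsAdaAFW

namespace IsAdaPFW

lemma step_invariant (hR : IsAdaPFW f A δ ε Linit T R) (hδ : 0 < δ) (hε : 0 ≤ ε) (ht : t < T)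
    (hx : IsDecomposition A (R.x t) (R.α t)) (hL : 0 < prevEstimate Linit R.L t) :
    0 ≤ R.γmax t ∧ IsDecomposition A (R.x (t + 1)) (R.α (t + 1)) := by
  have hc := hR.common t ht
  have hs := hR.subproblems t ht
  have hle := hc.γ_le_max
  have hmax : 0 ≤ R.γmax t := by
    rw [hR.max_step t ht]
    exact WithTop.coe_le_coe.2 (hx.nonneg _)
  rw [hR.max_step t ht, WithTop.coe_le_coe] at hle
  rw [hc.update, hR.weights t ht, hR.direction t ht]
  exact ⟨hmax, hx.pairwise_update hs.s_mem (hx.isActiveSet.1 hs.v_mem)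
    (hc.γ_nonneg hδ hε hL hmax) hle⟩

lemma invariant (hR : IsAdaPFW f A δ ε Linit T R) (hδ : 0 < δ) (hε : 0 ≤ ε) (hL : 0 < Linit)
    (ht : t ≤ T) :
    IsDecomposition A (R.x t) (R.α t) ∧ 0 < prevEstimate Linit R.L t := by
  induction t with
  | zero => exact ⟨by rw [hR.init_weights]; exact .of_mem hR.init_mem, hL⟩
  | succ t ih =>
    obtain ⟨h1, h2⟩ := ih (by omega)
    exact ⟨(hR.step_invariant hδ hε ht h1 h2).2, (hR.common t ht).L_pos h2⟩

theorem rate [FiniteDimensional ℝ E] (hR : IsAdaPFW f A δ ε Linit T R) (hμ : 0 < μ)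
    (hδ : 0 < δ) (hδ1 : δ ≤ 1) (hε : 0 ≤ ε) (hL : 0 < Linit) (hC : IsCompact (convexHull ℝ A))
    (hd : ∀ x ∈ convexHull ℝ A, DifferentiableAt ℝ f x)
    (hf : StrongConvexOn (convexHull ℝ A) μ f) (ht : t < T) (hgood : R.GoodStep t) :
    subopt f (convexHull ℝ A) (R.x (t + 1)) ≤
        (1 - δ ^ 2 * (μ / (4 * R.L t) * (PWidth A / Metric.diam A) ^ 2)) *
          subopt f (convexHull ℝ A) (R.x t) ∧
      subopt f (convexHull ℝ A) (R.x (t + 1)) ≤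
        (1 - min (δ / 2) (δ ^ 2 * (μ / R.L t) *
            (PWidth A / Metric.diam (convexHull ℝ A)) ^ 2)) *
          subopt f (convexHull ℝ A) (R.x t) := by
  have hA : Bornology.IsBounded A := hC.isBounded.subset (subset_convexHull ℝ A)
  obtain ⟨hx, hLt⟩ := hR.invariant hδ hε hL ht.le
  obtain ⟨hmax, hx'⟩ := hR.step_invariant hδ hε ht hx hLt
  have hc := hR.common t ht
  have hs := hR.subproblems t ht
  have hvA := hx.isActiveSet.1 hs.v_mem
  have hxC := hx.isActiveSet.mem_convexHull
  have hh := subopt_nonneg (bddBelow_image hC hd) hxC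
  have hLpos := hc.L_pos hLt
  have hdir := hR.direction t ht
  have hdD : ‖R.d t‖ ≤ Metric.diam A := by
    rw [hdir]
    exact norm_sub_le_diam hA (subset_convexHull ℝ A hs.s_mem) (subset_convexHull ℝ A hvA)
  -- the gaps `⟪-∇f(x), x - v⟫` average to `0` over the active set, so the selected one is not
  -- negative
  have haway : 0 ≤ ⟪-gradient f (R.x t), R.x t - R.v t⟫ := by
    by_contra! hneg
    obtain ⟨-, w, w0, w1, w2⟩ := hx.isActiveSet
    have hlt : ∀ v ∈ (R.α t).support, ⟪-gradient f (R.x t), R.x t - v⟫ < 0 := fun v hv => by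
      have := (hs.away_le hv).trans_lt hneg
      by_contra! h0
      exact absurd this (not_lt.2 (mul_nonneg hδ.le h0))
    have h1 := weight_mul_inner_le (y := R.x t) (n := gradient f (R.x t)) w0 w1 w2
      (fun v hv => by have := hlt v hv; rw [inner_neg_left] at this; linarith) hs.v_mem
    rw [sub_self, inner_zero_right] at h1
    rw [inner_neg_left] at hneg
    exact absurd h1 (not_le.2 (mul_pos (w0 _ hs.v_mem) (by linarith)))
  have hfw : ⟪-gradient f (R.x t), R.s t - R.x t⟫ ≤ gap f (R.x t) (R.d t) := by
    rw [gap, hdir, ← sub_add_sub_cancel (R.s t) (R.x t) (R.v t), inner_add_right]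
    linarith
  rw [convexHull_diam]
  rcases hc.rate_of_goodStep hgood hs hx hx' hμ hδ hε hLt hmax hC hd hf hdD (κ := δ)
    hδ.le (by rw [gap, hdir]) hfw with h | ⟨h, hμL⟩
  · constructor <;> refine h.trans (mul_le_mul_of_nonneg_right (sub_le_sub_left ?_ 1) hh)
    · gcongr
      linarith
    · rw [← mul_assoc]
      exact min_le_right _ _
  · constructor <;> refine h.trans (mul_le_mul_of_nonneg_right (sub_le_sub_left ?_ 1) hh)
    · exact rate_le_half hδ hδ1 hμ hμL (PWidth_nonneg hA) (PWidth_le_diam hA)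
    · exact min_le_left _ _

end IsAdaPFW

end FrankWolfe

/-! ### Matching Pursuit -/

section MatchingPursuit

variable {E : Type*} [NormedAddCommGroup E] [InnerProductSpace ℝ E]

lemma neg_mem_symmAtoms {E : Type*} [NormedAddCommGroup E] {A : Set E} {z : E} (hz : z ∈ symmAtoms A) : -z ∈ symmAtoms A := by
  rcases hz with h | h
  · exact Or.inr (by simpa using h)
  · exact Or.inl h

lemma span_symmAtoms (A : Set E) : Submodule.span ℝ (symmAtoms A) = Submodule.span ℝ A := by
  refine le_antisymm (Submodule.span_le.2 ?_) (Submodule.span_mono Set.subset_union_left)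
  rintro z (h | h)
  · exact Submodule.subset_span h
  · have := (Submodule.span ℝ A).neg_mem (Submodule.subset_span h)
    simpa using this

lemma sSup_directional_nonneg {A : Set E} (hB : Bornology.IsBounded (symmAtoms A))
    (hne : (symmAtoms A).Nonempty) (d : E) :
    0 ≤ sSup {c : ℝ | ∃ z ∈ symmAtoms A, c = ⟪z, d⟫ / ‖d‖} := by
  obtain ⟨z, hz⟩ := hne
  obtain ⟨D, hD⟩ := isBounded_iff_forall_norm_le.1 hB
  have hbdd : BddAbove {c : ℝ | ∃ z ∈ symmAtoms A, c = ⟪z, d⟫ / ‖d‖} := by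
    refine ⟨D, ?_⟩
    rintro c ⟨z, hz, rfl⟩
    refine div_le_of_le_mul₀ (norm_nonneg _) ((norm_nonneg z).trans (hD z hz)) ?_
    exact (real_inner_le_norm _ _).trans (by gcongr; exact hD z hz)
  have h1 := le_csSup hbdd ⟨z, hz, rfl⟩
  have h2 := le_csSup hbdd ⟨-z, neg_mem_symmAtoms hz, rfl⟩
  rw [inner_neg_left, neg_div] at h2
  linarith

lemma mDW_nonneg {A : Set E} (hB : Bornology.IsBounded (symmAtoms A))
    (hne : (symmAtoms A).Nonempty) : 0 ≤ mDW (symmAtoms A) :=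
  Real.sInf_nonneg (by
    rintro b ⟨d, -, -, rfl⟩
    exact sSup_directional_nonneg hB hne d)

lemma mDW_mul_norm_le {A : Set E} (hB : Bornology.IsBounded (symmAtoms A))
    (hne : (symmAtoms A).Nonempty) {d : E} (hd : d ∈ Submodule.span ℝ A) {G : ℝ}
    (hG0 : 0 ≤ G) (hG : ∀ z ∈ symmAtoms A, ⟪z, d⟫ ≤ G) : mDW (symmAtoms A) * ‖d‖ ≤ G := by
  by_cases hd0 : d = 0
  · simpa [hd0] using hG0
  have hpos : 0 < ‖d‖ := norm_pos_iff.2 hd0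
  rw [← le_div_iff₀ hpos]
  have hle : mDW (symmAtoms A) ≤ sSup {c : ℝ | ∃ z ∈ symmAtoms A, c = ⟪z, d⟫ / ‖d‖} := by
    refine csInf_le ⟨0, ?_⟩ ⟨d, by rwa [span_symmAtoms], hd0, rfl⟩
    rintro b ⟨d, -, -, rfl⟩
    exact sSup_directional_nonneg hB hne d
  refine hle.trans (csSup_le ?_ ?_)
  · obtain ⟨z, hz⟩ := hne
    exact ⟨_, z, hz, rfl⟩
  · rintro c ⟨z, hz, rfl⟩
    gcongr
    exact hG z hz

lemma norm_le_radius {E : Type*} [NormedAddCommGroup E] {B : Set E}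
    (hB : Bornology.IsBounded B) {z : E} (hz : z ∈ B) :
    ‖z‖ ≤ radius B := by
  obtain ⟨D, hD⟩ := isBounded_iff_forall_norm_le.1 hB
  refine le_csSup ⟨D, ?_⟩ ⟨z, hz, rfl⟩
  rintro c ⟨z, hz, rfl⟩
  exact hD z hz

/-- On a subspace, the suboptimality is controlled by the projected gradient. -/
lemma two_mul_subopt_le [CompleteSpace E] {V : Submodule ℝ E} [V.HasOrthogonalProjection] {μ : ℝ}
    {f : E → ℝ} (hμ : 0 < μ) (hf : StrongConvexOn (V : Set E) μ f) {x : E} (hx : x ∈ V)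
    (hd : DifferentiableAt ℝ f x) :
    2 * μ * subopt f V x ≤ ‖V.starProjection (gradient f x)‖ ^ 2 := by
  set p := V.starProjection (gradient f x) with hp
  have hlb : f x - ‖p‖ ^ 2 / (2 * μ) ≤ sInf (f '' V) := by
    refine le_csInf ⟨_, x, hx, rfl⟩ ?_
    rintro _ ⟨z, hz, rfl⟩
    have h1 := strongConvexOn_first_order hf hx hz hd
    have h2 := V.starProjection_inner_eq_zero (gradient f x) (z - x) (sub_mem hz hx)
    rw [inner_sub_left, ← hp, sub_eq_zero] at h2
    rw [h2] at h1
    have h3 : -(‖p‖ * ‖z - x‖) ≤ ⟪p, z - x⟫ := neg_le_of_abs_le (abs_real_inner_le_norm _ _)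
    have h4 : ‖p‖ * ‖z - x‖ ≤ ‖p‖ ^ 2 / (2 * μ) + μ / 2 * ‖z - x‖ ^ 2 := by
      have h5 : ‖p‖ ^ 2 / (2 * μ) + μ / 2 * ‖z - x‖ ^ 2 - ‖p‖ * ‖z - x‖ =
          (‖p‖ - μ * ‖z - x‖) ^ 2 / (2 * μ) := by
        field_simp; ring
      have h6 : 0 ≤ (‖p‖ - μ * ‖z - x‖) ^ 2 / (2 * μ) := by positivity
      linarith
    linarith
  have h1 : subopt f V x ≤ ‖p‖ ^ 2 / (2 * μ) := by
    rw [subopt]; linarith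
  rw [le_div_iff₀ (by positivity)] at h1
  linarith

variable [CompleteSpace E] {f : E → ℝ} {A : Set E} {δ ε Linit μ : ℝ} {T t : ℕ} {R : Trace E}

namespace IsAdaMP

lemma invariant (hR : IsAdaMP f A δ ε Linit T R) (hL : 0 < Linit) (ht : t ≤ T) :
    R.x t ∈ Submodule.span ℝ A ∧ 0 < prevEstimate Linit R.L t := by
  induction t with
  | zero => exact ⟨hR.init_mem, hL⟩
  | succ t ih =>
    obtain ⟨h1, h2⟩ := ih (by omega)
    refine ⟨?_, (hR.common t ht).L_pos h2⟩
    rw [(hR.common t ht).update]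
    refine add_mem h1 (Submodule.smul_mem _ _ ?_)
    rw [← span_symmAtoms]
    exact Submodule.subset_span (hR.direction_mem t ht)

theorem rate [FiniteDimensional ℝ E] (hR : IsAdaMP f A δ ε Linit T R) (hμ : 0 < μ)
    (hδ : 0 < δ) (hε : 0 ≤ ε) (hL : 0 < Linit) (hB : IsCompact (symmAtoms A))
    (hd : ∀ x ∈ Submodule.span ℝ A, DifferentiableAt ℝ f x)
    (hf : StrongConvexOn (Submodule.span ℝ A : Set E) μ f) (ht : t < T) :
    subopt f (Submodule.span ℝ A) (R.x (t + 1)) ≤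
      (1 - δ ^ 2 * (μ / R.L t * (mDW (symmAtoms A) / radius (symmAtoms A)) ^ 2)) *
        subopt f (Submodule.span ℝ A) (R.x t) := by
  obtain ⟨hx, hLt⟩ := hR.invariant hL ht.le
  have hc := hR.common t ht
  have hmem := hR.direction_mem t ht
  have hg := hc.gap_pos hδ hε
  have hne : (symmAtoms A).Nonempty := ⟨_, hmem⟩
  have hw := mDW_nonneg hB.isBounded hne
  have hG0 : 0 ≤ gap f (R.x t) (R.d t) / δ := by positivity
  have hmax : R.γmax t = ⊤ := hR.max_step t ht
  refine hc.rate_of_inactive hδ hε hLt (by rw [hmax]; exact le_top)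
    (by rw [hmax]; exact WithTop.coe_ne_top) (norm_le_radius hB.isBounded hmem)
    (G := gap f (R.x t) (R.d t) / δ) (by positivity) (mul_div_cancel₀ _ hδ.ne').le ?_
  set V := Submodule.span ℝ A with hV
  have hproj : mDW (symmAtoms A) * ‖V.starProjection (gradient f (R.x t))‖ ≤
      gap f (R.x t) (R.d t) / δ := by
    refine mDW_mul_norm_le hB.isBounded hne (V.starProjection_apply_mem _) hG0 fun z hz => ?_
    have hzV : z ∈ V := by
      rw [hV, ← span_symmAtoms]
      exact Submodule.subset_span hz
    have h1 := V.starProjection_inner_eq_zero (gradient f (R.x t)) z hzV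
    rw [inner_sub_left, sub_eq_zero] at h1
    rw [real_inner_comm, ← h1, le_div_iff₀ hδ, gap, inner_neg_left]
    have h2 := hR.direction_quality t ht (-z) (neg_mem_symmAtoms hz)
    rw [inner_neg_right] at h2
    linarith
  have h1 := two_mul_subopt_le hμ hf hx (hd _ hx)
  calc 2 * μ * mDW (symmAtoms A) ^ 2 * subopt f V (R.x t)
      = mDW (symmAtoms A) ^ 2 * (2 * μ * subopt f V (R.x t)) := by ring
    _ ≤ mDW (symmAtoms A) ^ 2 * ‖V.starProjection (gradient f (R.x t))‖ ^ 2 := by gcongr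
    _ = (mDW (symmAtoms A) * ‖V.starProjection (gradient f (R.x t))‖) ^ 2 := by ring
    _ ≤ (gap f (R.x t) (R.d t) / δ) ^ 2 := by gcongr

end IsAdaMP

end MatchingPursuit

end AdaFW

theorem theorem3 (p : ℕ) (A : Set (EuclideanSpace ℝ (Fin p)))
    (f : EuclideanSpace ℝ (Fin p) → ℝ) (μ δ ε Linit : ℝ)
    (hμ : 0 < μ) (hδ : 0 < δ) (hδ1 : δ ≤ 1) (hε : 0 ≤ ε) (hL : 0 < Linit) :
    -- Frank-Wolfe variants, on the domain `conv A`
    (IsCompact (convexHull ℝ A) →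
      (∀ x ∈ convexHull ℝ A, DifferentiableAt ℝ f x) →
      StrongConvexOn (convexHull ℝ A) μ f →
      -- Away-steps Frank-Wolfe
      (∀ (T : ℕ) (R : AdaFW.ActiveTrace (EuclideanSpace ℝ (Fin p))),
        AdaFW.IsAdaAFW f A δ ε Linit T R →
        ∀ t < T, R.GoodStep t →
          AdaFW.subopt f (convexHull ℝ A) (R.x (t + 1)) ≤
            (1 - δ ^ 2 * (μ / (4 * R.L t) * (AdaFW.PWidth A / Metric.diam A) ^ 2)) *
              AdaFW.subopt f (convexHull ℝ A) (R.x t)) ∧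
      -- Pairwise Frank-Wolfe
      (∀ (T : ℕ) (R : AdaFW.ActiveTrace (EuclideanSpace ℝ (Fin p))),
        AdaFW.IsAdaPFW f A δ ε Linit T R →
        ∀ t < T, R.GoodStep t →
          AdaFW.subopt f (convexHull ℝ A) (R.x (t + 1)) ≤
            (1 - δ ^ 2 * (μ / (4 * R.L t) * (AdaFW.PWidth A / Metric.diam A) ^ 2)) *
              AdaFW.subopt f (convexHull ℝ A) (R.x t) ∧
          AdaFW.subopt f (convexHull ℝ A) (R.x (t + 1)) ≤
            (1 - min (δ / 2) (δ ^ 2 * (μ / R.L t) *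
                (AdaFW.PWidth A / Metric.diam (convexHull ℝ A)) ^ 2)) *
              AdaFW.subopt f (convexHull ℝ A) (R.x t))) ∧
    -- Matching Pursuit, on the domain `lin A`
    (IsCompact (AdaFW.symmAtoms A) →
      (∀ x ∈ Submodule.span ℝ A, DifferentiableAt ℝ f x) →
      StrongConvexOn (Submodule.span ℝ A : Set (EuclideanSpace ℝ (Fin p))) μ f →
      ∀ (T : ℕ) (R : AdaFW.Trace (EuclideanSpace ℝ (Fin p))),
        AdaFW.IsAdaMP f A δ ε Linit T R →
        ∀ t < T,
          AdaFW.subopt f (Submodule.span ℝ A) (R.x (t + 1)) ≤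
            (1 - δ ^ 2 * (μ / R.L t *
                (AdaFW.mDW (AdaFW.symmAtoms A) / AdaFW.radius (AdaFW.symmAtoms A)) ^ 2)) *
              AdaFW.subopt f (Submodule.span ℝ A) (R.x t)) := by
  refine ⟨fun hC hd hf => ⟨fun T R hR t ht hgood => ?_, fun T R hR t ht hgood => ?_⟩,
    fun hB hd hf T R hR t ht => ?_⟩
  · exact hR.rate hμ hδ hδ1 hε hL hC hd hf ht hgood
  · exact hR.rate hμ hδ hδ1 hε hL hC hd hf ht hgood
  · exact hR.rate hμ hδ hε hL hB hd hf ht
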